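/- Let $A$ be a (not necessarily unital) complex $C^*$-algebra. Subalgebras of $C^*$-algebras are norm-closed $*$-subalgebras and ideals are closed and two-sided. A minimal projection in a $C^*$-algebra $B$ is a nonzero projection $p\in B$ ($p=p^*=p^2$) with $pBp=\mathbb{C}p$, and $\mathcal{I}^{At}(B)$ denotes the $C^*$-subalgebra of $B$ generated by all minimal projections of $B$ (it is $\{0\}$ if there are none). A sequence $(\mathcal{I}_\alpha)_{\alpha\le\theta}$ of ideals indexed by ordinals is increasing if $\mathcal{I}_\alpha\subsetneq\mathcal{I}_\beta$ for $\alpha<\beta\le\theta$, and continuous if $\mathcal{I}_\lambda=\overline{\bigcup_{\alpha<\lambda}\mathcal{I}_\alpha}$ for every nonzero limit ordinal $\lambda\le\theta$. Then the following six conditions are equivalent: 1. Every nonzero $*$-homomorphic image of $A$ (that is, every nonzero $C^*$-algebra $B$ admitting a surjective $*$-homomorphism $A\to B$) has a minimal projection. 2. There are an ordinal $ht(A)$ and a continuous increasing sequence of ideals $(\mathcal{I}_\alpha)_{\alpha\le ht(A)}$ of $A$ with $\mathcal{I}_0=\{0\}$, $\mathcal{I}_{ht(A)}=A$ and $$\mathcal{I}^{At}(A/\mathcal{I}_\alpha)=\{[a]_{\mathcal{I}_\alpha}: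 a\in\mathcal{I}_{\alpha+1}\}\qquad\text{for every }\alpha<ht(A).$$ 3. There are an ordinal $m(A)$ and a continuous increasing sequence of ideals $(\mathcal{J}_\alpha)_{\alpha\le m(A)}$ of $A$ with $\mathcal{J}_0=\{0\}$, $\mathcal{J}_{m(A)}=A$ such that for every $\alpha<m(A)$ the quotient $\mathcal{J}_{\alpha+1}/\mathcal{J}_\alpha$ is an elementary $C^*$-algebra, i.e. $*$-isomorphic to the algebra of all compact operators on some complex Hilbert space. 4. Every nonzero $C^*$-subalgebra of $A$ has a minimal projection. 5. $A$ does not contain a copy of $C_0((0,1])=\{f\in C((0,1],\mathbb{C}):\lim_{x\to0}f(x)=0\}$; that is, there is no injective $*$-homomorphism $C_0((0,1])\to A$. 6. Every self-adjoint element of $A$ has countable spectrum (computed in the unitization of $A$ if $A$ is not unital). -/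

import Mathlib

open scoped ZeroAtInfty

universe u

/-- A closed two-sided ideal of a (not necessarily unital) `C^*`-algebra. -/
structure ClosedIdeal (A : Type u) [NonUnitalCStarAlgebra A] extends Submodule ℂ A where
  mul_mem_left' : ∀ (a : A) {x : A}, x ∈ carrier → a * x ∈ carrier
  mul_mem_right' : ∀ (a : A) {x : A}, x ∈ carrier → x * a ∈ carrier
  isClosed' : IsClosed carrier

namespace ClosedIdeal

section Basic

variable {A : Type u} [NonUnitalCStarAlgebra A]

theorem toSubmodule_injective :
    Function.Injective (toSubmodule : ClosedIdeal A → Submodule ℂ A) := by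
  rintro ⟨s, _, _, _⟩ ⟨t, _, _, _⟩ h
  cases h
  rfl

instance : SetLike (ClosedIdeal A) A where
  coe I := I.carrier
  coe_injective _ _ h := toSubmodule_injective (SetLike.coe_injective h)

/-- Closed ideals are ordered by inclusion. -/
instance : PartialOrder (ClosedIdeal A) := PartialOrder.ofSetLike (ClosedIdeal A) A

theorem mem_toSubmodule {I : ClosedIdeal A} {x : A} : x ∈ I.toSubmodule ↔ x ∈ I := Iff.rfl

theorem mul_mem_left (I : ClosedIdeal A) (a : A) {x : A} (hx : x ∈ I) : a * x ∈ I :=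
  I.mul_mem_left' a hx

theorem mul_mem_right (I : ClosedIdeal A) (a : A) {x : A} (hx : x ∈ I) : x * a ∈ I :=
  I.mul_mem_right' a hx

theorem isClosed (I : ClosedIdeal A) : IsClosed (I : Set A) := I.isClosed'

instance (I : ClosedIdeal A) : IsClosed (I.toSubmodule : Set A) := I.isClosed'

/-- For self-adjoint `b` in a closed ideal `I` and `δ > 0` there is a self-adjoint `u ∈ I` with
`‖1 - u‖ ≤ 1` in the unitization, such that `‖y - y * u‖ ^ 2 ≤ δ` whenever `star y * y = b`. -/
theorem exists_approx (I : ClosedIdeal A) {b : A} (hb : b ∈ I) (hsa : IsSelfAdjoint b)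
    {δ : ℝ} (hδ : 0 < δ) :
    ∃ u ∈ I, IsSelfAdjoint u ∧ ‖(1 - (u : Unitization ℂ A))‖ ≤ 1 ∧
      ∀ y : A, star y * y = b → ‖y - y * u‖ * ‖y - y * u‖ ≤ δ := by
  let f : ℝ → ℝ := fun x => x ^ 2 / (x ^ 2 + δ ^ 2)
  let g : ℝ → ℝ := fun x => 1 - f x
  have hpos : ∀ x : ℝ, 0 < x ^ 2 + δ ^ 2 := fun x => by positivity
  have hf : Continuous f := by
    refine Continuous.div (by fun_prop) (by fun_prop) fun x => (hpos x).ne'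
  have hg : Continuous g := by fun_prop
  have hgx : ∀ x, g x = δ ^ 2 / (x ^ 2 + δ ^ 2) := fun x => by
    have := (hpos x).ne'
    simp only [g, f]
    field_simp
    ring
  have hf0 : f 0 = 0 := by simp [f]
  let S : NonUnitalStarSubalgebra ℝ A :=
    { carrier := {x | x ∈ I ∧ star x ∈ I}
      add_mem' := fun {x y} hx hy => ⟨I.add_mem hx.1 hy.1, by
        rw [star_add]; exact I.add_mem hx.2 hy.2⟩
      zero_mem' := ⟨I.zero_mem, by rw [star_zero]; exact I.zero_mem⟩
      mul_mem' := fun {x y} hx hy => ⟨I.mul_mem_left _ hy.1, by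
        rw [star_mul]; exact I.mul_mem_left _ hx.2⟩
      smul_mem' := fun c x hx => ⟨by
        have := I.smul_mem (c : ℂ) hx.1
        simpa using! this, by
        have := I.smul_mem (c : ℂ) hx.2
        rw [star_smul]
        simpa using! this⟩
      star_mem' := fun {x} hx => ⟨hx.2, by rw [star_star]; exact hx.1⟩ }
  have hS : IsClosed (S : Set A) :=
    I.isClosed.inter (I.isClosed.preimage continuous_star)
  have hbS : b ∈ S := ⟨hb, by rw [hsa.star_eq]; exact hb⟩
  have : IsClosed (S : Set A) := hS
  have hu : cfcₙ f b ∈ S := cfcₙ_mem (𝕜' := ℝ) (s := S) f hbS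
  have husa : IsSelfAdjoint (cfcₙ f b) := IsSelfAdjoint.cfcₙ
  have hwsa : IsSelfAdjoint (b : Unitization ℂ A) := Unitization.isSelfAdjoint_inr (R := ℂ) |>.2 hsa
  have hv : 1 - ((cfcₙ f b : A) : Unitization ℂ A) = cfc g (b : Unitization ℂ A) := by
    rw [Unitization.real_cfcₙ_eq_cfc_inr b f hf0,
      cfc_sub (fun _ => 1) f (b : Unitization ℂ A) (by fun_prop) hf.continuousOn, cfc_const_one ℝ _]
  refine ⟨cfcₙ f b, hu.1, husa, ?_, fun y hy => ?_⟩
  · rw [hv]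
    refine norm_cfc_le zero_le_one fun x _ => ?_
    rw [hgx, Real.norm_of_nonneg (by positivity), div_le_one (hpos x)]
    nlinarith [sq_nonneg x]
  · have key : ((y - y * cfcₙ f b : A) : Unitization ℂ A)
        = (y : Unitization ℂ A) * cfc g (b : Unitization ℂ A) := by
      rw [← hv]
      simp [mul_sub]
    have hgsa : star (cfc g (b : Unitization ℂ A)) = cfc g (b : Unitization ℂ A) :=
      (IsSelfAdjoint.cfc (f := g)).star_eq
    have h2 : star ((y : Unitization ℂ A) * cfc g (b : Unitization ℂ A)) *
        ((y : Unitization ℂ A) * cfc g (b : Unitization ℂ A))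
        = cfc (fun x => g x * x * g x) (b : Unitization ℂ A) := by
      rw [star_mul, hgsa, mul_assoc, ← mul_assoc (star _), ← Unitization.inr_star,
        ← Unitization.inr_mul, hy, ← mul_assoc,
        cfc_mul (fun x => g x * x) g (b : Unitization ℂ A) (by fun_prop) (by fun_prop),
        cfc_mul g (fun x => x) (b : Unitization ℂ A) (by fun_prop) (by fun_prop), cfc_id' ℝ _]
    rw [← Unitization.norm_inr (𝕜 := ℂ), key, ← CStarRing.norm_star_mul_self, h2]
    refine norm_cfc_le hδ.le fun x _ => ?_
    have hp := hpos x
    rw [hgx, Real.norm_eq_abs, abs_mul, abs_mul,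
      abs_of_nonneg (show (0 : ℝ) ≤ δ ^ 2 / (x ^ 2 + δ ^ 2) by positivity)]
    have h3 : δ ^ 2 / (x ^ 2 + δ ^ 2) ≤ 1 := by
      rw [div_le_one hp]; nlinarith [sq_nonneg x]
    have h4 : δ ^ 2 / (x ^ 2 + δ ^ 2) * |x| ≤ δ := by
      rw [div_mul_eq_mul_div, div_le_iff₀ hp]
      nlinarith [sq_nonneg (|x| - δ), sq_abs x, abs_nonneg x]
    calc _ ≤ δ * 1 := by gcongr
      _ = δ := mul_one δ

theorem star_mem (I : ClosedIdeal A) {a : A} (ha : a ∈ I) : star a ∈ I := by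
  rw [← SetLike.mem_coe, ← I.isClosed.closure_eq, Metric.mem_closure_iff]
  intro ε hε
  obtain ⟨u, huI, -, -, hu⟩ := I.exists_approx (I.mul_mem_right (star a) ha)
    (IsSelfAdjoint.mul_star_self a) (show (0 : ℝ) < (ε / 2) * (ε / 2) by positivity)
  refine ⟨star a * u, I.mul_mem_left _ huI, ?_⟩
  have h := hu (star a) (by rw [star_star])
  rw [dist_eq_norm]
  have := abs_le_of_sq_le_sq' (by simpa [sq] using h) (by positivity : (0:ℝ) ≤ ε / 2)
  linarith [this.2]

end Basic

section Quotient

variable {A : Type u} [NonUnitalCStarAlgebra A]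

/-- The quotient `A / I`, as a vector space, with the quotient norm. -/
def Quotient (I : ClosedIdeal A) : Type u := A ⧸ I.toSubmodule

namespace Quotient

variable (I : ClosedIdeal A)

noncomputable instance : NormedAddCommGroup I.Quotient :=
  inferInstanceAs (NormedAddCommGroup (A ⧸ I.toSubmodule))

noncomputable instance : NormedSpace ℂ I.Quotient :=
  inferInstanceAs (NormedSpace ℂ (A ⧸ I.toSubmodule))

instance : CompleteSpace I.Quotient :=
  inferInstanceAs (CompleteSpace (A ⧸ I.toSubmodule))

/-- The class `[a]` of `a` in `A / I`. -/
def mk (a : A) : I.Quotient := Submodule.Quotient.mk a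

theorem mk_surjective : Function.Surjective (mk I) := Submodule.Quotient.mk_surjective _

theorem mk_eq_mk {a b : A} : mk I a = mk I b ↔ a - b ∈ I :=
  Submodule.Quotient.eq I.toSubmodule

theorem mk_add (a b : A) : mk I (a + b) = mk I a + mk I b := rfl

theorem mk_smul (c : ℂ) (a : A) : mk I (c • a) = c • mk I a := rfl

theorem mk_zero : mk I 0 = 0 := rfl

theorem norm_mk_le (a : A) : ‖mk I a‖ ≤ ‖a‖ := Submodule.Quotient.norm_mk_le I.toSubmodule a

theorem exists_norm_lt (x : I.Quotient) {ε : ℝ} (hε : 0 < ε) :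
    ∃ a : A, mk I a = x ∧ ‖a‖ < ‖x‖ + ε :=
  Submodule.Quotient.norm_mk_lt (S := I.toSubmodule) x hε

instance : Mul I.Quotient where
  mul := Quotient.map₂ (· * ·) fun a a' ha b b' hb => by
    replace ha := (Submodule.quotientRel_def I.toSubmodule).1 ha
    replace hb := (Submodule.quotientRel_def I.toSubmodule).1 hb
    refine (Submodule.quotientRel_def I.toSubmodule).2 ?_
    have : a * b - a' * b' = a * (b - b') + (a - a') * b' := by noncomm_ring
    simp only [this]
    exact I.toSubmodule.add_mem (I.mul_mem_left' _ hb) (I.mul_mem_right' _ ha)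

theorem mk_mul (a b : A) : mk I (a * b) = mk I a * mk I b := rfl

instance : Star I.Quotient where
  star := Quotient.map star fun a a' ha => by
    replace ha := (Submodule.quotientRel_def I.toSubmodule).1 ha
    refine (Submodule.quotientRel_def I.toSubmodule).2 ?_
    rw [← star_sub]
    exact I.star_mem ha

theorem mk_star (a : A) : mk I (star a) = star (mk I a) := rfl

noncomputable instance : NonUnitalNormedRing I.Quotient where
  __ := (inferInstance : NormedAddCommGroup I.Quotient)
  left_distrib x y z := by
    obtain ⟨a, rfl⟩ := mk_surjective I x
    obtain ⟨b, rfl⟩ := mk_surjective I y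
    obtain ⟨c, rfl⟩ := mk_surjective I z
    exact congrArg (mk I) (mul_add a b c)
  right_distrib x y z := by
    obtain ⟨a, rfl⟩ := mk_surjective I x
    obtain ⟨b, rfl⟩ := mk_surjective I y
    obtain ⟨c, rfl⟩ := mk_surjective I z
    exact congrArg (mk I) (add_mul a b c)
  zero_mul x := by
    obtain ⟨a, rfl⟩ := mk_surjective I x
    exact congrArg (mk I) (zero_mul a)
  mul_zero x := by
    obtain ⟨a, rfl⟩ := mk_surjective I x
    exact congrArg (mk I) (mul_zero a)
  mul_assoc x y z := by
    obtain ⟨a, rfl⟩ := mk_surjective I x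
    obtain ⟨b, rfl⟩ := mk_surjective I y
    obtain ⟨c, rfl⟩ := mk_surjective I z
    exact congrArg (mk I) (mul_assoc a b c)
  norm_mul_le x y := by
    have hlim : Filter.Tendsto (fun ε : ℝ => (‖x‖ + ε) * (‖y‖ + ε)) (nhdsWithin 0 (Set.Ioi 0))
        (nhds (‖x‖ * ‖y‖)) := by
      have : Continuous fun ε : ℝ => (‖x‖ + ε) * (‖y‖ + ε) := by fun_prop
      simpa using (this.tendsto 0).mono_left nhdsWithin_le_nhds
    refine ge_of_tendsto hlim ?_
    filter_upwards [self_mem_nhdsWithin] with ε (hε : 0 < ε)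
    obtain ⟨a, rfl, ha⟩ := exists_norm_lt I x hε
    obtain ⟨b, rfl, hb⟩ := exists_norm_lt I y hε
    calc ‖mk I a * mk I b‖ ≤ ‖a * b‖ := norm_mk_le I (a * b)
      _ ≤ ‖a‖ * ‖b‖ := norm_mul_le a b
      _ ≤ _ := by gcongr

noncomputable instance : StarRing I.Quotient where
  star_involutive x := by
    obtain ⟨a, rfl⟩ := mk_surjective I x
    exact congrArg (mk I) (star_star a)
  star_mul x y := by
    obtain ⟨a, rfl⟩ := mk_surjective I x
    obtain ⟨b, rfl⟩ := mk_surjective I y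
    exact congrArg (mk I) (star_mul a b)
  star_add x y := by
    obtain ⟨a, rfl⟩ := mk_surjective I x
    obtain ⟨b, rfl⟩ := mk_surjective I y
    exact congrArg (mk I) (star_add a b)

instance : IsScalarTower ℂ I.Quotient I.Quotient where
  smul_assoc c x y := by
    obtain ⟨a, rfl⟩ := mk_surjective I x
    obtain ⟨b, rfl⟩ := mk_surjective I y
    exact congrArg (mk I) (smul_mul_assoc c a b)

instance : SMulCommClass ℂ I.Quotient I.Quotient where
  smul_comm c x y := by
    obtain ⟨a, rfl⟩ := mk_surjective I x
    obtain ⟨b, rfl⟩ := mk_surjective I y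
    exact congrArg (mk I) (mul_smul_comm c a b).symm

instance : StarModule ℂ I.Quotient where
  star_smul c x := by
    obtain ⟨a, rfl⟩ := mk_surjective I x
    exact congrArg (mk I) (star_smul c a)

instance : CStarRing I.Quotient where
  norm_mul_self_le x := by
    obtain ⟨a, rfl⟩ := mk_surjective I x
    refine le_of_forall_pos_le_add fun ε hε => ?_
    obtain ⟨z, hz, hzlt⟩ := exists_norm_lt I (star (mk I a) * mk I a) (half_pos hε)
    have hi : z - star a * a ∈ I := (mk_eq_mk I).1 hz
    obtain ⟨i, rfl⟩ : ∃ i, z = star a * a + i := ⟨z - star a * a, by abel⟩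
    rw [add_sub_cancel_left] at hi
    obtain ⟨u, huI, husa, hu1, hu⟩ := I.exists_approx (I.mul_mem_left (star i) hi)
      (IsSelfAdjoint.star_mul_self i) (show (0 : ℝ) < (ε / 2) * (ε / 2) by positivity)
    have hiu : ‖i - i * u‖ ≤ ε / 2 :=
      (abs_le_of_sq_le_sq' (by simpa [sq] using hu i rfl) (by positivity)).2
    have hmk : mk I a = mk I (a - a * u) := by
      rw [mk_eq_mk, sub_sub_cancel]
      exact I.mul_mem_left _ huI
    have hle : ‖mk I a‖ ≤ ‖a - a * u‖ := by
      rw [hmk]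
      exact norm_mk_le I _
    set v : Unitization ℂ A := 1 - (u : Unitization ℂ A) with hvdef
    have hv : star v = v := by
      rw [hvdef, star_sub, star_one, ← Unitization.inr_star, husa.star_eq]
    have e1 : ((a - a * u : A) : Unitization ℂ A) = (a : Unitization ℂ A) * v := by
      simp [hvdef, mul_sub]
    have e2 : ((i - i * u : A) : Unitization ℂ A) = (i : Unitization ℂ A) * v := by
      simp [hvdef, mul_sub]
    have e3 : star ((a : Unitization ℂ A) * v) * ((a : Unitization ℂ A) * v)
        = v * ((star a * a + i : A) : Unitization ℂ A) * v - v * ((i : Unitization ℂ A) * v) := by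
      rw [star_mul, hv]
      simp only [Unitization.inr_add, Unitization.inr_mul, Unitization.inr_star]
      noncomm_ring
    calc ‖mk I a‖ * ‖mk I a‖ ≤ ‖a - a * u‖ * ‖a - a * u‖ := by gcongr
      _ = ‖v * ((star a * a + i : A) : Unitization ℂ A) * v - v * ((i : Unitization ℂ A) * v)‖ := by
        rw [← Unitization.norm_inr (𝕜 := ℂ), e1, ← CStarRing.norm_star_mul_self, e3]
      _ ≤ ‖v‖ * ‖((star a * a + i : A) : Unitization ℂ A)‖ * ‖v‖
          + ‖v‖ * ‖(i : Unitization ℂ A) * v‖ := by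
        refine (norm_sub_le _ _).trans (add_le_add ?_ (norm_mul_le _ _))
        exact (norm_mul_le _ _).trans (by gcongr; exact norm_mul_le _ _)
      _ ≤ 1 * ‖star a * a + i‖ * 1 + 1 * (ε / 2) := by
        rw [← e2, Unitization.norm_inr, Unitization.norm_inr]
        gcongr
      _ ≤ ‖star (mk I a) * mk I a‖ + ε := by linarith

/-- The quotient of a `C^*`-algebra by a closed two-sided ideal is a `C^*`-algebra. -/
noncomputable instance : NonUnitalCStarAlgebra I.Quotient where

/-- The quotient map `a ↦ [a]` as a `*`-homomorphism. -/
def mkHom : A →⋆ₙₐ[ℂ] I.Quotient where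
  toFun := mk I
  map_smul' _ _ := rfl
  map_zero' := rfl
  map_add' _ _ := rfl
  map_mul' _ _ := rfl
  map_star' _ := rfl

end Quotient

/-- A closed ideal, viewed as a `C^*`-subalgebra. -/
def toStarSubalgebra (I : ClosedIdeal A) : NonUnitalStarSubalgebra ℂ A where
  __ := I.toSubmodule
  mul_mem' {x _} _ hy := I.mul_mem_left' x hy
  star_mem' hx := I.star_mem hx

/-- `J / I = {[a] : a ∈ J}` as a `*`-subalgebra of `A / I`
(to be used for `I ≤ J`, when it is the quotient of `J` by `I`). -/
noncomputable def subquotient (J I : ClosedIdeal A) : NonUnitalStarSubalgebra ℂ I.Quotient :=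
  J.toStarSubalgebra.map (Quotient.mkHom I)

end Quotient

end ClosedIdeal

/-- A minimal projection: a nonzero projection `p` with `p B p = ℂ p`. -/
def IsMinimalProjection {B : Type u} [NonUnitalRing B] [StarRing B] [Module ℂ B] (p : B) : Prop :=
  p ≠ 0 ∧ IsStarProjection p ∧
    Set.range (fun b : B => p * b * p) = Set.range (fun c : ℂ => c • p)

/-- The `C^*`-subalgebra generated by the minimal projections. -/
noncomputable def atomicIdeal (B : Type u) [NonUnitalCStarAlgebra B] :
    NonUnitalStarSubalgebra ℂ B :=
  (NonUnitalStarAlgebra.adjoin ℂ {p : B | IsMinimalProjection p}).topologicalClosure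

/-- The compact operators on a Hilbert space, as a closed ideal of the bounded operators. -/
def compactIdeal (H : Type u) [NormedAddCommGroup H] [InnerProductSpace ℂ H] [CompleteSpace H] :
    ClosedIdeal (H →L[ℂ] H) where
  __ := compactOperator (RingHom.id ℂ) H H
  mul_mem_left' a _ hx := IsCompactOperator.clm_comp hx a
  mul_mem_right' a _ hx := IsCompactOperator.comp_clm hx a
  isClosed' := by
    have h := (compactOperator (RingHom.id ℂ) H H).isClosed_topologicalClosure
    rwa [compactOperator_topologicalClosure] at h

/-- An elementary `C^*`-algebra: one that is `*`-isomorphic to the algebra of all compact operators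
on some complex Hilbert space. -/
def IsElementary (B : Type u) [NonUnitalRing B] [StarRing B] [Module ℂ B] : Prop :=
  ∃ (H : Type u) (_ : NormedAddCommGroup H) (_ : InnerProductSpace ℂ H) (_ : CompleteSpace H),
    Nonempty (B ≃⋆ₐ[ℂ] (compactIdeal H).toStarSubalgebra)

/-- `(I α)_{α ≤ o}` is a continuous increasing sequence of closed ideals from `{0}` to `A`.
The values of `I` above `o` play no role. -/
structure IsIdealSeries {A : Type u} [NonUnitalCStarAlgebra A] (o : Ordinal.{u})
    (I : Ordinal.{u} → ClosedIdeal A) : Prop where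
  strictMonoOn : StrictMonoOn I (Set.Iic o)
  zero : (I 0 : Set A) = {0}
  top : (I o : Set A) = Set.univ
  limit : ∀ l ≤ o, Order.IsSuccLimit l → (I l : Set A) = closure (⋃ α < l, (I α : Set A))

/-! Condition 6 is the hub; the implications proved are 1 ⇔ 2, 1 → 3 → 6 → 1 and 6 → 4 → 5 → 6.
Spectra appear as quasispectra, that is, spectra in the unitization; the extra point `0` does not
affect countability.

Building series (1 → 2, 1 → 3): as long as an ideal `I` is proper, `A / I` has a minimal projection,
and pulling back an ideal containing it enlarges `I`. Iterating along the ordinals must reach `A`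
(`exists_isIdealSeries`). The closed span of all minimal projections, which is an ideal, gives 2.
The ideal generated by one minimal projection `p` gives 3: `B p` is a Hilbert space with `star x * y
= ⟪x, y⟫ • p`, and left multiplication identifies that ideal with the compact operators
(`isElementary_generatedIdeal`). Conversely, the first stage of a series not killed by a surjection
is a successor, which yields 2 → 1 (`IsIdealSeries.exists_le_ker`).

3 → 6: compact self-adjoint operators have countable spectrum, and countability climbs the series by
transfinite induction, since spectral points lost in a quotient are detected by functional calculus
inside the ideal (`countable_quasispectrum_of_quotients`).

6 → 4 and 6 → 1: countable spectra have gaps, so there are many spectral projections. Without a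
minimal one, every projection splits, and the resulting binary tree carries a self-adjoint element
whose spectrum contains a Cantor set (`exists_not_countable_quasispectrum_of_tree`). Condition 6
passes to quotients.

4 → 5 → 6: `C₀((0, 1])` has no nonzero projection; and an uncountable compact spectrum maps
continuously onto `[0, 1]`, so functional calculus produces an element generating a copy of `C₀((0,
1])`. -/

namespace ClosedIdeal

/-! ### The lattice of closed ideals; preimages and quotients. -/

section Lattice

variable {A B : Type u} [NonUnitalCStarAlgebra A] [NonUnitalCStarAlgebra B]

/-- The closure of an algebraic two-sided ideal. -/
def ofClosure (S : Submodule ℂ A) (hl : ∀ a : A, ∀ x ∈ S, a * x ∈ S)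
    (hr : ∀ a : A, ∀ x ∈ S, x * a ∈ S) : ClosedIdeal A where
  __ := S.topologicalClosure
  mul_mem_left' a x hx :=
    map_mem_closure (f := fun x => a * x) (by fun_prop) hx fun y hy => hl a y hy
  mul_mem_right' a x hx :=
    map_mem_closure (f := fun x => x * a) (by fun_prop) hx fun y hy => hr a y hy
  isClosed' := S.isClosed_topologicalClosure

theorem coe_ofClosure (S : Submodule ℂ A) (hl : ∀ a : A, ∀ x ∈ S, a * x ∈ S)
    (hr : ∀ a : A, ∀ x ∈ S, x * a ∈ S) : (ofClosure S hl hr : Set A) = closure (S : Set A) := rfl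

instance : InfSet (ClosedIdeal A) where
  sInf s :=
    { (⨅ I ∈ s, I.toSubmodule : Submodule ℂ A) with
      mul_mem_left' := fun a x hx => by
        simp only [AddSubsemigroup.mem_carrier,
          AddSubmonoid.mem_toSubsemigroup, Submodule.mem_toAddSubmonoid, Submodule.mem_iInf] at hx ⊢
        exact fun I hI => I.mul_mem_left a (hx I hI)
      mul_mem_right' := fun a x hx => by
        simp only [AddSubsemigroup.mem_carrier,
          AddSubmonoid.mem_toSubsemigroup, Submodule.mem_toAddSubmonoid, Submodule.mem_iInf] at hx ⊢
        exact fun I hI => I.mul_mem_right a (hx I hI)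
      isClosed' := by
        change IsClosed ((⨅ I ∈ s, I.toSubmodule : Submodule ℂ A) : Set A)
        simp only [Submodule.coe_iInf]
        exact isClosed_biInter fun I _ => I.isClosed }

theorem mem_sInf {s : Set (ClosedIdeal A)} {x : A} : x ∈ sInf s ↔ ∀ I ∈ s, x ∈ I := by
  change x ∈ (⨅ I ∈ s, I.toSubmodule : Submodule ℂ A) ↔ _
  simp only [Submodule.mem_iInf, mem_toSubmodule]

/-- Closed ideals form a complete lattice. -/
instance : CompleteLattice (ClosedIdeal A) :=
  completeLatticeOfInf _ fun _ =>
    ⟨fun I hI _ hx => mem_sInf.1 hx I hI, fun _ hJ _ hx => mem_sInf.2 fun _ hI => hJ hI hx⟩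

/-- The zero ideal. -/
def zeroIdeal : ClosedIdeal A where
  __ := (⊥ : Submodule ℂ A)
  mul_mem_left' a x hx := by
    obtain rfl : x = 0 := hx
    simp
  mul_mem_right' a x hx := by
    obtain rfl : x = 0 := hx
    simp
  isClosed' := isClosed_singleton (x := (0 : A))

theorem mem_bot {x : A} : x ∈ (⊥ : ClosedIdeal A) ↔ x = 0 := by
  constructor
  · intro hx
    have : (⊥ : ClosedIdeal A) ≤ zeroIdeal := bot_le
    exact this hx
  · rintro rfl
    exact (⊥ : ClosedIdeal A).toSubmodule.zero_mem

/-- The whole algebra as an ideal. -/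
def univIdeal : ClosedIdeal A where
  __ := (⊤ : Submodule ℂ A)
  mul_mem_left' _ _ _ := trivial
  mul_mem_right' _ _ _ := trivial
  isClosed' := isClosed_univ

theorem mem_top (x : A) : x ∈ (⊤ : ClosedIdeal A) := by
  have : (univIdeal : ClosedIdeal A) ≤ ⊤ := le_top
  exact this (show x ∈ (⊤ : Submodule ℂ A) from trivial)

theorem eq_top_iff_coe {I : ClosedIdeal A} : I = ⊤ ↔ (I : Set A) = Set.univ := by
  constructor
  · rintro rfl
    exact Set.eq_univ_of_forall mem_top
  · intro h
    refine top_le_iff.1 fun x _ => ?_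
    rw [← SetLike.mem_coe, h]
    trivial

/-- A directed union of ideals is already an algebraic ideal, so only its closure has to be taken.
This is the continuity of a series at limit stages. -/
theorem coe_iSup_of_directed {ι : Type*} [Nonempty ι] {I : ι → ClosedIdeal A}
    (hI : Directed (· ≤ ·) I) :
    ((⨆ i, I i : ClosedIdeal A) : Set A) = closure (⋃ i, (I i : Set A)) := by
  have hdir : Directed (· ≤ ·) fun i => (I i).toSubmodule := hI
  have hmem (x : A) : x ∈ (⨆ i, (I i).toSubmodule) ↔ ∃ i, x ∈ I i :=
    Submodule.mem_iSup_of_directed _ hdir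
  let J : ClosedIdeal A := ofClosure (⨆ i, (I i).toSubmodule)
    (fun a x hx => by
      obtain ⟨i, hi⟩ := (hmem x).1 hx
      exact (hmem _).2 ⟨i, (I i).mul_mem_left a hi⟩)
    (fun a x hx => by
      obtain ⟨i, hi⟩ := (hmem x).1 hx
      exact (hmem _).2 ⟨i, (I i).mul_mem_right a hi⟩)
  have hJ : (J : Set A) = closure (⋃ i, (I i : Set A)) := by
    rw [coe_ofClosure]
    congr 1
    ext x
    simp [hmem]
  have : (⨆ i, I i) = J := by
    refine le_antisymm (iSup_le fun i x hx => ?_) fun x hx => ?_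
    · rw [← SetLike.mem_coe, hJ]
      exact subset_closure (Set.mem_iUnion.2 ⟨i, hx⟩)
    · rw [← SetLike.mem_coe, hJ] at hx
      exact closure_minimal (Set.iUnion_subset fun i => (le_iSup I i : I i ≤ _))
        (⨆ i, I i : ClosedIdeal A).isClosed hx
  rw [this, hJ]

/-- The preimage of a closed ideal under a `*`-homomorphism. -/
noncomputable def comap (φ : A →⋆ₙₐ[ℂ] B) (J : ClosedIdeal B) : ClosedIdeal A where
  carrier := φ ⁻¹' J
  add_mem' {x y} hx hy := by
    rw [Set.mem_preimage, map_add]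
    exact J.toSubmodule.add_mem hx hy
  zero_mem' := by
    rw [Set.mem_preimage, map_zero]
    exact J.toSubmodule.zero_mem
  smul_mem' c x hx := by
    rw [Set.mem_preimage, map_smul]
    exact J.toSubmodule.smul_mem c hx
  mul_mem_left' a x hx := by
    rw [Set.mem_preimage, map_mul]
    exact J.mul_mem_left _ hx
  mul_mem_right' a x hx := by
    rw [Set.mem_preimage, map_mul]
    exact J.mul_mem_right _ hx
  isClosed' := J.isClosed.preimage
    (AddMonoidHomClass.continuous_of_bound φ 1 fun x => by
      simpa using NonUnitalStarAlgHom.norm_apply_le φ x)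

theorem mem_comap {φ : A →⋆ₙₐ[ℂ] B} {J : ClosedIdeal B} {x : A} : x ∈ comap φ J ↔ φ x ∈ J :=
  Iff.rfl

theorem mem_comap_bot {φ : A →⋆ₙₐ[ℂ] B} {x : A} : x ∈ comap φ ⊥ ↔ φ x = 0 :=
  mem_comap.trans mem_bot

namespace Quotient

variable (I : ClosedIdeal A)

theorem mkHom_apply (a : A) : mkHom I a = mk I a := rfl

theorem mk_eq_zero {a : A} : mk I a = 0 ↔ a ∈ I := by
  rw [← mk_zero, mk_eq_mk, sub_zero]

theorem nontrivial_iff : Nontrivial I.Quotient ↔ I ≠ ⊤ := by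
  rw [← not_iff_not, not_nontrivial_iff_subsingleton, not_not, subsingleton_iff_forall_eq 0]
  constructor
  · intro h
    exact top_le_iff.1 fun x _ => (mk_eq_zero I).1 (h _)
  · rintro rfl x
    obtain ⟨a, rfl⟩ := mk_surjective _ x
    exact (mk_eq_zero _).2 (mem_top a)

variable {I} in
/-- A `*`-homomorphism that vanishes on `I` factors through `A / I`. -/
noncomputable def lift (φ : A →⋆ₙₐ[ℂ] B) (h : I ≤ comap φ ⊥) : I.Quotient →⋆ₙₐ[ℂ] B where
  toFun := I.toSubmodule.liftQ (φ : A →ₗ[ℂ] B) fun _ hx => mem_comap_bot.1 (h hx)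
  map_smul' c x := map_smul _ c x
  map_zero' := map_zero _
  map_add' x y := map_add _ x y
  map_mul' x y := by
    obtain ⟨a, rfl⟩ := mk_surjective I x
    obtain ⟨b, rfl⟩ := mk_surjective I y
    exact map_mul φ a b
  map_star' x := by
    obtain ⟨a, rfl⟩ := mk_surjective I x
    exact map_star φ a

end Quotient

theorem le_comap_mkHom (I : ClosedIdeal A) (K : ClosedIdeal I.Quotient) :
    I ≤ comap (Quotient.mkHom I) K := fun x hx => by
  rw [mem_comap, Quotient.mkHom_apply, (Quotient.mk_eq_zero I).2 hx]
  exact K.toSubmodule.zero_mem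

theorem lt_comap_mkHom (I : ClosedIdeal A) {K : ClosedIdeal I.Quotient} {x : I.Quotient}
    (hx : x ∈ K) (hx0 : x ≠ 0) : I < comap (Quotient.mkHom I) K := by
  refine lt_of_le_not_ge (le_comap_mkHom I K) fun h => ?_
  obtain ⟨a, rfl⟩ := Quotient.mk_surjective I x
  exact hx0 ((Quotient.mk_eq_zero I).2 (h (mem_comap.2 hx)))

theorem coe_subquotient (J I : ClosedIdeal A) :
    (J.subquotient I : Set I.Quotient) = {x | ∃ a ∈ J, Quotient.mk I a = x} := rfl

theorem mem_subquotient_comap {I : ClosedIdeal A} {K : ClosedIdeal I.Quotient} {x : I.Quotient} :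
    x ∈ (comap (Quotient.mkHom I) K).subquotient I ↔ x ∈ K := by
  rw [← SetLike.mem_coe, coe_subquotient]
  constructor
  · rintro ⟨a, ha, rfl⟩
    exact ha
  · intro hx
    obtain ⟨a, rfl⟩ := Quotient.mk_surjective I x
    exact ⟨a, hx, rfl⟩

end Lattice

end ClosedIdeal

/-! ### Transfinite series of ideals. -/

section Series

open ClosedIdeal

variable {A B : Type u} [NonUnitalCStarAlgebra A] [NonUnitalCStarAlgebra B]

/-- Iterating a strictly increasing operation on closed ideals produces an ideal series. -/
theorem exists_isIdealSeries (D : ClosedIdeal A → ClosedIdeal A) (hD : ∀ I ≠ ⊤, I < D I) :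
    ∃ (o : Ordinal.{u}) (I : Ordinal.{u} → ClosedIdeal A), IsIdealSeries o I ∧
      ∀ α < o, I α ≠ ⊤ ∧ I (α + 1) = D (I α) := by
  classical
  -- Nothing is assumed about `D ⊤`; forcing `⊤` to be fixed makes the operation inflationary
  -- everywhere, as transfinite iteration requires.
  let E : ClosedIdeal A → ClosedIdeal A := fun I => if I = ⊤ then ⊤ else D I
  have hE (I : ClosedIdeal A) (hI : I ≠ ⊤) : E I = D I := if_neg hI
  have hE_lt (I : ClosedIdeal A) (hI : I ≠ ⊤) : I < E I := (hE I hI).symm ▸ hD I hI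
  have hE_le (I : ClosedIdeal A) : I ≤ E I := by
    by_cases hI : I = ⊤
    · simp [E, hI]
    · exact (hE_lt I hI).le
  let I : Ordinal.{u} → ClosedIdeal A := fun α => transfiniteIterate E α ⊥
  have hmono : Monotone I := monotone_transfiniteIterate E ⊥ hE_le
  have hsucc (α : Ordinal.{u}) : I (α + 1) = E (I α) := by
    rw [← Order.succ_eq_add_one]
    exact transfiniteIterate_succ E ⊥ α (not_isMax α)
  -- If the iteration never reached `⊤` it would be strictly increasing, hence an injection of all
  -- ordinals of the universe into a small type.
  have hex : ∃ α, I α = ⊤ := by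
    have : Small.{u} (ClosedIdeal A) :=
      small_of_injective (SetLike.coe_injective : Function.Injective ((↑) : ClosedIdeal A → Set A))
    exact top_mem_range_transfiniteIterate E ⊥ hE_lt (if_pos rfl) (not_injective_of_ordinal _)
  obtain ⟨o, ho, hmin⟩ := WellFounded.has_min (wellFounded_lt (α := Ordinal.{u})) {α | I α = ⊤} hex
  have hne (α : Ordinal.{u}) (hα : α < o) : I α ≠ ⊤ := fun h => hmin α h hα
  refine ⟨o, I, ⟨fun α hα β hβ hαβ => ?_, ?_, eq_top_iff_coe.1 ho, fun l _ hl => ?_⟩,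
    fun α hα => ⟨hne α hα, (hsucc α).trans (hE _ (hne α hα))⟩⟩
  · calc I α < E (I α) := hE_lt _ (hne α (hαβ.trans_le hβ))
      _ = I (α + 1) := (hsucc α).symm
      _ ≤ I β := hmono (Order.add_one_le_of_lt hαβ)
  · have : I 0 = ⊥ := transfiniteIterate_bot (J := Ordinal.{u}) E ⊥
    rw [this]
    ext x
    exact mem_bot
  · have hl0 : Nonempty (Set.Iio l) := ⟨⟨0, hl.bot_lt⟩⟩
    have : I l = ⨆ x : Set.Iio l, I x.1 := transfiniteIterate_limit E ⊥ l hl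
    rw [this, coe_iSup_of_directed, Set.iUnion_subtype]
    · rfl
    · exact (hmono.comp (Subtype.mono_coe _)).directed_le

/-- The first ideal of a series that is not contained in the kernel of a nonzero surjection occurs
at a successor stage. -/
theorem IsIdealSeries.exists_le_ker {o : Ordinal.{u}} {I : Ordinal.{u} → ClosedIdeal A}
    (hI : IsIdealSeries o I) [Nontrivial B] {φ : A →⋆ₙₐ[ℂ] B} (hφ : Function.Surjective φ) :
    ∃ β < o, I β ≤ comap φ ⊥ ∧ ∃ a ∈ I (β + 1), φ a ≠ 0 := by
  have hex : ∃ α, α ≤ o ∧ ¬ I α ≤ comap φ ⊥ := by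
    refine ⟨o, le_rfl, fun h => ?_⟩
    obtain ⟨b, hb⟩ := exists_ne (0 : B)
    obtain ⟨a, rfl⟩ := hφ b
    refine hb (mem_comap_bot.1 (h ?_))
    rw [← SetLike.mem_coe, hI.top]
    trivial
  obtain ⟨α, ⟨hαo, hα⟩, hmin⟩ := WellFounded.has_min (wellFounded_lt (α := Ordinal.{u})) _ hex
  have hlt (β : Ordinal.{u}) (hβ : β < α) : I β ≤ comap φ ⊥ := by
    by_contra h
    exact hmin β ⟨hβ.le.trans hαo, h⟩ hβ
  rcases Ordinal.zero_or_succ_or_isSuccLimit α with rfl | ⟨β, rfl⟩ | hlim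
  · refine absurd (fun x hx => ?_) hα
    rw [← SetLike.mem_coe, hI.zero] at hx
    rw [mem_comap_bot, Set.mem_singleton_iff.1 hx, map_zero]
  · refine ⟨β, (Order.lt_succ β).trans_le hαo, hlt β (Order.lt_succ β), ?_⟩
    obtain ⟨a, ha, ha'⟩ := SetLike.not_le_iff_exists.1 hα
    exact ⟨a, ha, fun h => ha' (mem_comap_bot.2 h)⟩
  -- The kernel is closed, so it contains the closure of a union of ideals it contains: the first
  -- failure cannot occur at a limit.
  · refine absurd (fun x hx => ?_) hα
    rw [← SetLike.mem_coe, hI.limit α hαo hlim] at hx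
    exact closure_minimal (Set.iUnion₂_subset hlt) (comap φ ⊥).isClosed hx

end Series

/-! ### Minimal projections and the atomic ideal. -/

section MinimalProjection

theorem isMinimalProjection_iff {B : Type u} [NonUnitalRing B] [StarRing B] [Module ℂ B]
    [IsScalarTower ℂ B B] [SMulCommClass ℂ B B] {p : B} :
    IsMinimalProjection p ↔
      p ≠ 0 ∧ IsStarProjection p ∧ ∀ b : B, ∃ c : ℂ, p * b * p = c • p := by
  refine and_congr_right fun _ => and_congr_right fun hp => ?_
  constructor
  · intro h b
    obtain ⟨c, hc⟩ : p * b * p ∈ Set.range (fun c : ℂ => c • p) := h ▸ Set.mem_range_self b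
    exact ⟨c, hc.symm⟩
  · intro h
    refine Set.Subset.antisymm ?_ ?_
    · rintro _ ⟨b, rfl⟩
      obtain ⟨c, hc⟩ := h b
      exact ⟨c, hc.symm⟩
    · rintro _ ⟨c, rfl⟩
      exact ⟨c • p, by simp [mul_smul_comm, smul_mul_assoc, hp.isIdempotentElem.eq]⟩

/-- The image of a minimal projection under a surjective `*`-homomorphism is minimal or zero. -/
theorem IsMinimalProjection.map {B C : Type u} [NonUnitalRing B] [StarRing B] [Module ℂ B]
    [IsScalarTower ℂ B B] [SMulCommClass ℂ B B] [NonUnitalRing C] [StarRing C] [Module ℂ C]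
    [IsScalarTower ℂ C C] [SMulCommClass ℂ C C] {p : B} (hp : IsMinimalProjection p)
    (φ : B →⋆ₙₐ[ℂ] C) (hφ : Function.Surjective φ) (h0 : φ p ≠ 0) : IsMinimalProjection (φ p) := by
  rw [isMinimalProjection_iff] at hp ⊢
  obtain ⟨-, hproj, hmin⟩ := hp
  refine ⟨h0, ⟨?_, ?_⟩, fun c => ?_⟩
  · rw [IsIdempotentElem, ← map_mul, hproj.isIdempotentElem.eq]
  · rw [IsSelfAdjoint, ← map_star, hproj.isSelfAdjoint.star_eq]
  · obtain ⟨b, rfl⟩ := hφ c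
    obtain ⟨z, hz⟩ := hmin b
    exact ⟨z, by rw [← map_mul, ← map_mul, hz, map_smul]⟩

variable {B : Type u} [NonUnitalCStarAlgebra B]

/-- A minimal projection of a closed ideal is a minimal projection of the algebra. -/
theorem IsMinimalProjection.of_ideal {S : NonUnitalStarSubalgebra ℂ B}
    (hS : ∀ (b : B), ∀ x ∈ S, b * x ∈ S) {p : S} (hp : IsMinimalProjection p) :
    IsMinimalProjection (p : B) := by
  rw [isMinimalProjection_iff] at hp ⊢
  obtain ⟨h0, hproj, hmin⟩ := hp
  have hidem : (p : B) * p = p := congrArg Subtype.val hproj.isIdempotentElem.eq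
  refine ⟨fun h => h0 (Subtype.ext h), ⟨hidem, congrArg Subtype.val hproj.isSelfAdjoint.star_eq⟩,
    fun b => ?_⟩
  -- Only `b * p` is known to lie in `S`, but `p * (b * p) * p = p * b * p`.
  obtain ⟨c, hc⟩ := hmin ⟨b * p, hS b p p.2⟩
  refine ⟨c, ?_⟩
  have := congrArg Subtype.val hc
  simp only [NonUnitalStarSubalgebra.coe_mul, NonUnitalStarSubalgebra.coe_smul] at this
  rw [← this, mul_assoc (p : B) (b * p) p, mul_assoc b, hidem, mul_assoc]

/-- For a minimal projection `p`, every `x * star x` with `x ∈ B p` is a multiple of a minimal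
projection. -/
theorem IsMinimalProjection.mul_star_mem_span {p : B} (hp : IsMinimalProjection p) {x : B}
    (hx : x * p = x) : x * star x ∈ Submodule.span ℂ {q : B | IsMinimalProjection q} := by
  rw [isMinimalProjection_iff] at hp
  obtain ⟨h0, hproj, hmin⟩ := hp
  have hstar : p * star x = star x := by
    conv_rhs => rw [← hx, star_mul, hproj.isSelfAdjoint.star_eq]
  obtain ⟨c, hc⟩ := hmin (star x * x)
  have hxx : star x * x = c • p := by
    rw [← hc, mul_assoc, mul_assoc (star x), hx, ← mul_assoc, hstar]
  by_cases hx0 : x = 0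
  · simp [hx0]
  have hc0 : c ≠ 0 := by
    rintro rfl
    rw [zero_smul] at hxx
    exact hx0 (CStarRing.star_mul_self_eq_zero_iff x |>.1 hxx)
  have hcs : star c = c := by
    have h1 : star (star x * x) = star x * x := by simp
    rw [hxx, star_smul, hproj.isSelfAdjoint.star_eq] at h1
    exact smul_left_injective ℂ h0 h1
  have hq : IsMinimalProjection (c⁻¹ • (x * star x)) := by
    rw [isMinimalProjection_iff]
    refine ⟨?_, ⟨?_, ?_⟩, fun b => ?_⟩
    · exact smul_ne_zero (inv_ne_zero hc0) fun h =>
        hx0 (CStarRing.mul_star_self_eq_zero_iff x |>.1 h)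
    · rw [IsIdempotentElem, smul_mul_smul_comm, mul_assoc x, ← mul_assoc (star x), hxx,
        smul_mul_assoc, hstar, mul_smul_comm, smul_smul, mul_assoc, inv_mul_cancel₀ hc0, mul_one]
    · rw [IsSelfAdjoint, star_smul, star_mul, star_star, star_inv₀, hcs]
    · obtain ⟨d, hd⟩ := hmin (star x * b * x)
      refine ⟨c⁻¹ * d, ?_⟩
      have : x * star x * b * (x * star x) = d • (x * star x) := by
        calc x * star x * b * (x * star x) = x * (p * star x) * b * (x * p * star x) := by
              rw [hstar, hx]
          _ = x * (p * (star x * b * x) * p) * star x := by simp only [mul_assoc]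
          _ = d • (x * star x) := by
            rw [hd, mul_smul_comm, hx, smul_mul_assoc]
      rw [smul_mul_assoc, smul_mul_smul_comm, this, smul_smul, smul_smul]
      congr 1
      ring
  have : x * star x = c • c⁻¹ • (x * star x) := by rw [smul_smul, mul_inv_cancel₀ hc0, one_smul]
  rw [this]
  exact Submodule.smul_mem _ _ (Submodule.subset_span hq)

/-- Polarization of `mul_star_mem_span`: every `b * p + z • p` lies in `B p`, so its product with
its adjoint is in the span. -/
theorem IsMinimalProjection.mul_mem_span {p : B} (hp : IsMinimalProjection p) (b : B) :
    b * p ∈ Submodule.span ℂ {q : B | IsMinimalProjection q} := by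
  have hproj : IsStarProjection p := hp.2.1
  have hpp : p * p = p := hproj.isIdempotentElem.eq
  have hps : star p = p := hproj.isSelfAdjoint.star_eq
  have key (z : ℂ) : (b * p + z • p) * star (b * p + z • p) ∈
      Submodule.span ℂ {q : B | IsMinimalProjection q} :=
    hp.mul_star_mem_span (by rw [add_mul, mul_assoc, smul_mul_assoc, hpp])
  -- With `x = b * p`, the product `(x + z p)(x + z p)*` is weighted by `z` and summed over the
  -- fourth roots of unity. Only the term `z * conj z • x` survives, four times.
  have polar : b * p = (1 / 4 : ℂ) • ((b * p + (1 : ℂ) • p) * star (b * p + (1 : ℂ) • p)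
      - (b * p + (-1 : ℂ) • p) * star (b * p + (-1 : ℂ) • p)
      + Complex.I • ((b * p + Complex.I • p) * star (b * p + Complex.I • p))
      - Complex.I • ((b * p + (-Complex.I) • p) * star (b * p + (-Complex.I) • p))) := by
    have h1 : b * p * p = b * p := by rw [mul_assoc, hpp]
    simp only [star_add, star_smul, hps, star_mul, add_mul, mul_add, smul_mul_assoc, mul_smul_comm,
      smul_add, smul_smul, hpp, h1, star_one, star_neg, RCLike.star_def, Complex.conj_I]
    match_scalars <;> ring_nf <;> norm_num [Complex.I_sq]
  rw [polar]
  refine Submodule.smul_mem _ _ (Submodule.sub_mem _ (Submodule.add_mem _ (Submodule.sub_mem _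
    (key _) (key _)) (Submodule.smul_mem _ _ (key _))) (Submodule.smul_mem _ _ (key _)))

theorem mul_mem_span_minimalProjection (b : B) {x : B}
    (hx : x ∈ Submodule.span ℂ {q : B | IsMinimalProjection q}) :
    b * x ∈ Submodule.span ℂ {q : B | IsMinimalProjection q} := by
  induction hx using Submodule.span_induction with
  | mem p hp => exact IsMinimalProjection.mul_mem_span hp b
  | zero => simp
  | add x y _ _ hx hy => rw [mul_add]; exact Submodule.add_mem _ hx hy
  | smul c x _ hx => rw [mul_smul_comm]; exact Submodule.smul_mem _ _ hx

theorem star_mem_span_minimalProjection {x : B}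
    (hx : x ∈ Submodule.span ℂ {q : B | IsMinimalProjection q}) :
    star x ∈ Submodule.span ℂ {q : B | IsMinimalProjection q} := by
  induction hx using Submodule.span_induction with
  | mem p hp =>
    rw [hp.2.1.isSelfAdjoint.star_eq]
    exact Submodule.subset_span hp
  | zero => simp
  | add x y _ _ hx hy => rw [star_add]; exact Submodule.add_mem _ hx hy
  | smul c x _ hx => rw [star_smul]; exact Submodule.smul_mem _ _ hx

theorem mem_span_minimalProjection_mul (b : B) {x : B}
    (hx : x ∈ Submodule.span ℂ {q : B | IsMinimalProjection q}) :
    x * b ∈ Submodule.span ℂ {q : B | IsMinimalProjection q} := by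
  have := star_mem_span_minimalProjection
    (mul_mem_span_minimalProjection (star b) (star_mem_span_minimalProjection hx))
  simpa using this

variable (B) in
/-- The closed linear span of the minimal projections, as a closed ideal. -/
noncomputable def atomicClosedIdeal : ClosedIdeal B :=
  ClosedIdeal.ofClosure (Submodule.span ℂ {q : B | IsMinimalProjection q})
    (fun a _ hx => mul_mem_span_minimalProjection a hx)
    (fun a _ hx => mem_span_minimalProjection_mul a hx)

variable (B) in
-- The span of the minimal projections is an ideal stable under `star`, so it is already the
-- `*`-algebra they generate.
theorem coe_atomicIdeal : (atomicIdeal B : Set B) = atomicClosedIdeal B := by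
  change closure (NonUnitalStarAlgebra.adjoin ℂ {q : B | IsMinimalProjection q} : Set B) =
    closure (Submodule.span ℂ {q : B | IsMinimalProjection q} : Set B)
  congr 1
  let S : NonUnitalStarSubalgebra ℂ B :=
    { Submodule.span ℂ {q : B | IsMinimalProjection q} with
      mul_mem' := fun {x y} _ hy => mul_mem_span_minimalProjection x hy
      star_mem' := fun {x} hx => star_mem_span_minimalProjection hx }
  have h1 : NonUnitalStarAlgebra.adjoin ℂ {q : B | IsMinimalProjection q} ≤ S :=
    NonUnitalStarAlgebra.adjoin_le fun q hq => Submodule.subset_span hq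
  refine Set.Subset.antisymm h1 ?_
  exact Submodule.span_le (p := (NonUnitalStarAlgebra.adjoin ℂ
    {q : B | IsMinimalProjection q}).toNonUnitalSubalgebra.toSubmodule).2
    (NonUnitalStarAlgebra.subset_adjoin ℂ _)

theorem IsMinimalProjection.mem_atomicClosedIdeal {p : B} (hp : IsMinimalProjection p) :
    p ∈ atomicClosedIdeal B := subset_closure (Submodule.subset_span hp)

/-- A `*`-homomorphism killing all minimal projections kills their closed span. -/
theorem exists_isMinimalProjection_of_atomicIdeal {C : Type u} [NonUnitalCStarAlgebra C]
    {φ : B →⋆ₙₐ[ℂ] C} {x : B} (hx : x ∈ atomicClosedIdeal B) (hφx : φ x ≠ 0) :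
    ∃ p : B, IsMinimalProjection p ∧ φ p ≠ 0 := by
  by_contra! h
  refine hφx (ClosedIdeal.mem_comap_bot.1 ?_)
  refine closure_minimal ?_ (ClosedIdeal.comap φ ⊥).isClosed hx
  exact Submodule.span_le (p := (ClosedIdeal.comap φ ⊥).toSubmodule).2
    fun p hp => ClosedIdeal.mem_comap_bot.2 (h p hp)

end MinimalProjection

/-! ### Conditions 1 and 2: the Cantor–Bendixson sequence. -/

section CantorBendixson

open ClosedIdeal

variable {A : Type u} [NonUnitalCStarAlgebra A]

theorem exists_cantorBendixson_of_quotient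
    (h : ∀ (B : Type u) [NonUnitalCStarAlgebra B] (π : A →⋆ₙₐ[ℂ] B),
      Function.Surjective π → Nontrivial B → ∃ p : B, IsMinimalProjection p) :
    ∃ (ht : Ordinal.{u}) (I : Ordinal.{u} → ClosedIdeal A), IsIdealSeries ht I ∧
      ∀ α < ht, (atomicIdeal (I α).Quotient : Set (I α).Quotient) =
        {x | ∃ a ∈ I (α + 1), ClosedIdeal.Quotient.mk (I α) a = x} := by
  obtain ⟨o, I, hI, hsucc⟩ := exists_isIdealSeries
    (fun I : ClosedIdeal A => comap (ClosedIdeal.Quotient.mkHom I) (atomicClosedIdeal I.Quotient)) fun I hI => by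
      obtain ⟨p, hp⟩ := h I.Quotient (ClosedIdeal.Quotient.mkHom I) (ClosedIdeal.Quotient.mk_surjective I)
        ((ClosedIdeal.Quotient.nontrivial_iff I).2 hI)
      exact lt_comap_mkHom I hp.mem_atomicClosedIdeal hp.1
  refine ⟨o, I, hI, fun α hα => ?_⟩
  rw [coe_atomicIdeal, (hsucc α hα).2, ← coe_subquotient]
  ext x
  exact mem_subquotient_comap.symm

/-- At the last stage `β` inside the kernel, `π` factors through `A / I β` and is nonzero on its
atomic ideal. Hence it is nonzero on some minimal projection, whose image is minimal. -/
theorem exists_isMinimalProjection_of_cantorBendixson {o : Ordinal.{u}}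
    {I : Ordinal.{u} → ClosedIdeal A} (hI : IsIdealSeries o I)
    (hat : ∀ α < o, (atomicIdeal (I α).Quotient : Set (I α).Quotient) =
        {x | ∃ a ∈ I (α + 1), ClosedIdeal.Quotient.mk (I α) a = x})
    {B : Type u} [NonUnitalCStarAlgebra B] {π : A →⋆ₙₐ[ℂ] B} (hπ : Function.Surjective π)
    [Nontrivial B] : ∃ p : B, IsMinimalProjection p := by
  obtain ⟨β, hβ, hker, a, ha, hπa⟩ := hI.exists_le_ker hπ
  have hmem : ClosedIdeal.Quotient.mk (I β) a ∈ atomicClosedIdeal (I β).Quotient := by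
    rw [← SetLike.mem_coe, ← coe_atomicIdeal, hat β hβ]
    exact ⟨a, ha, rfl⟩
  obtain ⟨p, hp, hp0⟩ := exists_isMinimalProjection_of_atomicIdeal
    (φ := ClosedIdeal.Quotient.lift π hker) hmem hπa
  refine ⟨_, hp.map (ClosedIdeal.Quotient.lift π hker) (fun b => ?_) hp0⟩
  obtain ⟨a, rfl⟩ := hπ b
  exact ⟨ClosedIdeal.Quotient.mk (I β) a, rfl⟩

end CantorBendixson

/-! ### Compact operators and the spectra of elementary algebras. -/

section CompactOperator

open InnerProductSpace

variable {H : Type u} [NormedAddCommGroup H] [InnerProductSpace ℂ H] [CompleteSpace H]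

theorem isCompactOperator_rankOne {H : Type u} [NormedAddCommGroup H] [InnerProductSpace ℂ H]
    (x y : H) : IsCompactOperator (rankOne ℂ x y) := by
  rw [rankOne_def']
  exact (isCompactOperator_of_locallyCompactSpace_dom (innerSL ℂ y)).clm_comp
    (ContinuousLinearMap.toSpanSingleton ℂ x)

/-- Compact operators are norm limits of finite sums of rank one operators. -/
theorem IsCompactOperator.mem_closure_span_rankOne {T : H →L[ℂ] H} (hT : IsCompactOperator T) :
    T ∈ closure (Submodule.span ℂ {S : H →L[ℂ] H | ∃ x y, S = rankOne ℂ x y} :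
      Set (H →L[ℂ] H)) := by
  rw [Metric.mem_closure_iff]
  intro ε hε
  have hcpt : IsCompact (closure (T '' Metric.closedBall 0 1)) :=
    IsCompactOperator.isCompact_closure_image_closedBall (f := (T : H →ₗ[ℂ] H)) hT 1
  obtain ⟨t, -, htfin, htcov⟩ := hcpt.finite_cover_balls (half_pos hε)
  -- `t` is a finite `ε / 2`-net of the image of the unit ball. Orthogonal projection onto its span
  -- moves each `T x` no further than the nearest net point does.
  let U : Submodule ℂ H := Submodule.span ℂ t
  have : FiniteDimensional ℂ U := FiniteDimensional.span_of_finite ℂ htfin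
  refine ⟨U.starProjection * T, ?_, ?_⟩
  · let b := stdOrthonormalBasis ℂ U
    rw [b.starProjection_eq_sum_rankOne, Finset.sum_mul]
    refine Submodule.sum_mem _ fun i _ => Submodule.subset_span ?_
    exact ⟨b i, ContinuousLinearMap.adjoint T (b i), InnerProductSpace.rankOne_comp ..⟩
  · rw [dist_eq_norm]
    refine lt_of_le_of_lt ?_ (half_lt_self hε)
    refine ContinuousLinearMap.opNorm_le_of_unit_norm (half_pos hε).le fun x hx => ?_
    have hxmem : T x ∈ closure (T '' Metric.closedBall 0 1) :=
      subset_closure ⟨x, by simp [hx], rfl⟩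
    obtain ⟨y, hy, hxy⟩ := Set.mem_iUnion₂.1 (htcov hxmem)
    have hyU : y ∈ U := Submodule.subset_span hy
    have h1 : ‖T x - U.starProjection (T x)‖ ≤ ‖T x - y‖ := by
      rw [Submodule.starProjection_minimal]
      exact ciInf_le ⟨0, by rintro _ ⟨z, rfl⟩; positivity⟩ (⟨y, hyU⟩ : U)
    rw [Metric.mem_ball, dist_eq_norm] at hxy
    exact h1.trans hxy.le

/-- The spectrum of a compact self-adjoint operator is countable. -/
theorem IsCompactOperator.countable_spectrum {T : H →L[ℂ] H} (hT : IsCompactOperator T)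
    (hsa : IsSelfAdjoint T) : (spectrum ℂ T).Countable := by
  have hsymm : (T : H →ₗ[ℂ] H).IsSymmetric := hsa.isSymmetric
  -- Unit eigenvectors for distinct eigenvalues in `E n` are orthogonal, so by Pythagoras their
  -- images under `T` are at least `1 / (n + 1)` apart. These images lie in a compact, hence
  -- separable, set, so there are only countably many.
  let E : ℕ → Set ℂ := fun n => {μ | μ ∈ spectrum ℂ T ∧ 1 / ((n : ℝ) + 1) < ‖μ‖}
  have hcov : spectrum ℂ T ⊆ {0} ∪ ⋃ n, E n := by
    intro μ hμ
    by_cases h0 : μ = 0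
    · exact Or.inl h0
    · obtain ⟨n, hn⟩ := exists_nat_one_div_lt (norm_pos_iff.2 h0)
      exact Or.inr (Set.mem_iUnion.2 ⟨n, hμ, hn⟩)
  refine Set.Countable.mono hcov ((Set.countable_singleton 0).union (Set.countable_iUnion fun n => ?_))
  have hr : (0 : ℝ) < 1 / ((n : ℝ) + 1) := by positivity
  have hvec (μ : E n) : ∃ v : H, ‖v‖ = 1 ∧ T v = (μ : ℂ) • v := by
    have hμ0 : (μ : ℂ) ≠ 0 := norm_pos_iff.1 (hr.trans μ.2.2)
    obtain ⟨v, hv⟩ := ((hT.hasEigenvalue_iff_mem_spectrum hμ0).2 μ.2.1).exists_hasEigenvector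
    have hv0 : ‖v‖ ≠ 0 := norm_ne_zero_iff.2 hv.2
    refine ⟨((‖v‖⁻¹ : ℝ) : ℂ) • v, by simp [norm_smul, hv0], ?_⟩
    have : T v = (μ : ℂ) • v := hv.apply_eq_smul
    rw [map_smul, this, smul_comm]
  choose v hv1 hTv using hvec
  have horth (μ ν : E n) (h : μ ≠ ν) : inner ℂ (v μ) (v ν) = 0 := by
    have := hsymm.orthogonalFamily_eigenspaces (i := (μ : ℂ)) (j := (ν : ℂ))
      (fun h' => h (Subtype.ext h'))
    exact this ⟨v μ, Module.End.mem_eigenspace_iff.2 (hTv μ)⟩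
      ⟨v ν, Module.End.mem_eigenspace_iff.2 (hTv ν)⟩
  have hsep (μ ν : E n) (h : μ ≠ ν) : 1 / ((n : ℝ) + 1) ≤ dist (T (v μ)) (T (v ν)) := by
    rw [dist_eq_norm, hTv, hTv]
    have h1 : ‖(μ : ℂ) • v μ - (ν : ℂ) • v ν‖ * ‖(μ : ℂ) • v μ - (ν : ℂ) • v ν‖ =
        ‖(μ : ℂ) • v μ‖ * ‖(μ : ℂ) • v μ‖ + ‖(ν : ℂ) • v ν‖ * ‖(ν : ℂ) • v ν‖ := by
      rw [sub_eq_add_neg, norm_add_sq_eq_norm_sq_add_norm_sq_of_inner_eq_zero (𝕜 := ℂ) _ _ (by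
        simp [inner_smul_left, inner_smul_right, horth μ ν h]), norm_neg]
    have h2 : ‖(μ : ℂ) • v μ‖ = ‖(μ : ℂ)‖ := by rw [norm_smul, hv1, mul_one]
    have h3 := μ.2.2
    rw [h2] at h1
    have h4 : ‖(μ : ℂ)‖ ^ 2 ≤ ‖(μ : ℂ) • v μ - (ν : ℂ) • v ν‖ ^ 2 := by nlinarith [sq_nonneg ‖(ν : ℂ) • v ν‖]
    exact h3.le.trans (abs_le_of_sq_le_sq' h4 (norm_nonneg _)).2
  have hcpt : IsCompact (closure (T '' Metric.closedBall 0 1)) :=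
    IsCompactOperator.isCompact_closure_image_closedBall (f := (T : H →ₗ[ℂ] H)) hT 1
  let S : Set H := Set.range fun μ : E n => T (v μ)
  have hSsep : TopologicalSpace.IsSeparable S := hcpt.isSeparable.mono (by
    rintro _ ⟨μ, rfl⟩
    exact subset_closure ⟨v μ, by simp [hv1], rfl⟩)
  have hdisc : DiscreteTopology S := DiscreteTopology.of_forall_le_dist hr (by
    rintro ⟨_, μ, rfl⟩ ⟨_, ν, rfl⟩ h
    exact hsep μ ν fun h' => h (by simp [h']))
  have := hSsep.separableSpace
  have hScount : S.Countable := (TopologicalSpace.separableSpace_iff_countable (α := S)).1 this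
  have hinj : Function.Injective fun μ : E n => T (v μ) := by
    intro μ ν h
    by_contra hne
    have := hsep μ ν hne
    have h' : T (v μ) = T (v ν) := h
    rw [h', dist_self] at this
    linarith
  have : Set.InjOn (fun μ : E n => T (v μ)) Set.univ := hinj.injOn
  have hu : (Set.univ : Set (E n)).Countable := Set.countable_of_injective_of_countable_image this (by
    rwa [Set.image_univ])
  exact Set.countable_coe_iff.1 (Set.countable_univ_iff.1 hu)

/-- Passing from all bounded operators to the compact ones creates no new nonzero spectrum: a
quasi-inverse `y` of a compact `x` satisfies `y = -(x + x * y)`, so it is compact too. -/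
theorem countable_quasispectrum_compact {T : (compactIdeal H).toStarSubalgebra}
    (hsa : IsSelfAdjoint T) : (quasispectrum ℂ T).Countable := by
  have hsa' : IsSelfAdjoint (T : H →L[ℂ] H) := congrArg Subtype.val hsa.star_eq
  refine Set.Countable.mono ?_
    ((Set.countable_singleton 0).union (IsCompactOperator.countable_spectrum (T := (T : H →L[ℂ] H))
      T.2 hsa'))
  intro μ hμ
  by_contra hcon
  simp only [Set.mem_union, Set.mem_singleton_iff, not_or] at hcon
  have h1 : μ ∉ quasispectrum ℂ (T : H →L[ℂ] H) := by
    rw [quasispectrum_eq_spectrum_union_zero]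
    simpa [or_comm, not_or] using hcon
  simp only [quasispectrum, Set.mem_ofPred_eq, not_forall, not_not] at h1
  obtain ⟨hu, hq⟩ := h1
  refine hμ hu ?_
  obtain ⟨y, hy1, hy2⟩ := isQuasiregular_iff.1 hq
  have hymem : y ∈ (compactIdeal H).toStarSubalgebra := by
    set x : H →L[ℂ] H := -(hu.unit⁻¹ • (T : H →L[ℂ] H)) with hx
    have hxm : x ∈ (compactIdeal H).toStarSubalgebra := 
      neg_mem (SMulMemClass.smul_mem (hu.unit⁻¹ : ℂˣ).val T.2)
    have : y = -(x + x * y) := by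
      rw [eq_neg_iff_add_eq_zero, ← hy1]; abel
    rw [this]
    exact neg_mem (add_mem hxm ((compactIdeal H).mul_mem_right y hxm))
  exact isQuasiregular_iff.2 ⟨⟨y, hymem⟩, Subtype.ext hy1, Subtype.ext hy2⟩

end CompactOperator

section Elementary

theorem IsElementary.countable_quasispectrum {B : Type u} [NonUnitalCStarAlgebra B]
    {S : NonUnitalStarSubalgebra ℂ B} (hS : IsElementary S) {x : B} (hx : x ∈ S)
    (hsa : IsSelfAdjoint x) : (quasispectrum ℂ x).Countable := by
  obtain ⟨H, _, _, _, ⟨e⟩⟩ := hS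
  let y : S := ⟨x, hx⟩
  have hy : IsSelfAdjoint y := Subtype.ext hsa.star_eq
  have hey : IsSelfAdjoint (e y) := by rw [IsSelfAdjoint, ← map_star, hy.star_eq]
  refine (countable_quasispectrum_compact hey).mono ?_
  have h1 : quasispectrum ℂ x ⊆ quasispectrum ℂ y :=
    NonUnitalAlgHom.quasispectrum_apply_subset (NonUnitalStarSubalgebraClass.subtype S) y
  have h2 : quasispectrum ℂ (e.symm (e y)) ⊆ quasispectrum ℂ (e y) :=
    NonUnitalAlgHom.quasispectrum_apply_subset e.symm (e y)
  rw [e.symm_apply_apply] at h2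
  exact h1.trans h2

end Elementary

/-! ### The Hilbert space `B p` and the elementary ideal generated by `p`. -/

section LeftIdeal

open InnerProductSpace

variable {B : Type u} [NonUnitalCStarAlgebra B]

/-- The left ideal `B p`, for a projection `p`. -/
def leftIdeal (p : B) : Submodule ℂ B where
  carrier := {x | x * p = x}
  add_mem' {x y} hx hy := by
    rw [Set.mem_ofPred_eq] at *
    rw [add_mul, hx, hy]
  zero_mem' := zero_mul p
  smul_mem' c x hx := by
    rw [Set.mem_ofPred_eq] at *
    rw [smul_mul_assoc, hx]

theorem mem_leftIdeal {p x : B} : x ∈ leftIdeal p ↔ x * p = x := Iff.rfl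

instance (p : B) : CompleteSpace (leftIdeal p) := by
  have : IsClosed (leftIdeal p : Set B) := isClosed_eq (by fun_prop) continuous_id
  exact this.completeSpace_coe

theorem IsMinimalProjection.mul_self {p : B} (hp : IsMinimalProjection p) : p * p = p :=
  hp.2.1.isIdempotentElem.eq

theorem IsMinimalProjection.star_eq {p : B} (hp : IsMinimalProjection p) : star p = p :=
  hp.2.1.isSelfAdjoint.star_eq

theorem IsMinimalProjection.mul_mem_leftIdeal {p : B} (hp : IsMinimalProjection p) (b : B) :
    b * p ∈ leftIdeal p := by
  rw [mem_leftIdeal, mul_assoc, hp.mul_self]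

theorem IsStarProjection.norm_eq_one {p : B} (hp : IsStarProjection p) (h0 : p ≠ 0) : ‖p‖ = 1 := by
  have h := CStarRing.norm_star_mul_self (x := p)
  rw [hp.isSelfAdjoint.star_eq, hp.isIdempotentElem.eq] at h
  exact (mul_eq_left₀ (norm_ne_zero_iff.2 h0)).1 h.symm

theorem IsMinimalProjection.norm_eq_one {p : B} (hp : IsMinimalProjection p) : ‖p‖ = 1 :=
  hp.2.1.norm_eq_one hp.1

theorem star_mul_mem_compression {p : B} (hp : IsMinimalProjection p) (x y : leftIdeal p) :
    p * (star (x : B) * y) * p = star (x : B) * y := by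
  have hx : p * star (x : B) = star (x : B) := by
    conv_rhs => rw [← mem_leftIdeal.1 x.2, star_mul, hp.star_eq]
  rw [← mul_assoc, hx, mul_assoc, mem_leftIdeal.1 y.2]

/-- Left multiplication by `b` on `B p`. -/
noncomputable def leftMulCLM (p b : B) : leftIdeal p →L[ℂ] leftIdeal p :=
  LinearMap.mkContinuous
    { toFun := fun x => ⟨b * x, by rw [mem_leftIdeal, mul_assoc, mem_leftIdeal.1 x.2]⟩
      map_add' := fun x y => Subtype.ext (mul_add b (x : B) y)
      map_smul' := fun c x => Subtype.ext (mul_smul_comm c b (x : B)) } ‖b‖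
    fun x => norm_mul_le b (x : B)

theorem coe_leftMulCLM (p b : B) (x : leftIdeal p) : (leftMulCLM p b x : B) = b * x := rfl

/-- The closed ideal generated by `p`. -/
noncomputable def generatedIdeal (p : B) : ClosedIdeal B :=
  ClosedIdeal.ofClosure (Submodule.span ℂ {z : B | ∃ x y, z = x * p * y})
    (fun a z hz => by
      induction hz using Submodule.span_induction with
      | mem z hz =>
        obtain ⟨x, y, rfl⟩ := hz
        exact Submodule.subset_span ⟨a * x, y, by simp only [mul_assoc]⟩
      | zero => simp
      | add x y _ _ hx hy => rw [mul_add]; exact Submodule.add_mem _ hx hy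
      | smul c x _ hx => rw [mul_smul_comm]; exact Submodule.smul_mem _ _ hx)
    (fun a z hz => by
      induction hz using Submodule.span_induction with
      | mem z hz =>
        obtain ⟨x, y, rfl⟩ := hz
        exact Submodule.subset_span ⟨x, y * a, by simp only [mul_assoc]⟩
      | zero => simp
      | add x y _ _ hx hy => rw [add_mul]; exact Submodule.add_mem _ hx hy
      | smul c x _ hx => rw [smul_mul_assoc]; exact Submodule.smul_mem _ _ hx)

theorem mul_mul_mem_generatedIdeal (p x y : B) : x * p * y ∈ generatedIdeal p :=
  subset_closure (Submodule.subset_span ⟨x, y, rfl⟩)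

theorem generatedIdeal_le (p : B) {J : ClosedIdeal B} (h : ∀ x y, x * p * y ∈ J) : generatedIdeal p ≤ J :=
  closure_minimal (Submodule.span_le (p := J.toSubmodule).2 (by
    rintro _ ⟨x, y, rfl⟩
    exact h x y)) J.isClosed

variable (p : B) [hp : Fact (IsMinimalProjection p)]

/-- The scalar `c` with `p * b * p = c • p`. -/
noncomputable def compressionCoeff (b : B) : ℂ :=
  ((isMinimalProjection_iff.1 hp.out).2.2 b).choose

theorem compressionCoeff_smul (b : B) : compressionCoeff p b • p = p * b * p :=
  ((isMinimalProjection_iff.1 hp.out).2.2 b).choose_spec.symm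

variable {p} in
theorem compressionCoeff_eq {b : B} {c : ℂ} (h : p * b * p = c • p) : compressionCoeff p b = c :=
  smul_left_injective ℂ hp.out.1 ((compressionCoeff_smul p b).trans h)

theorem compressionCoeff_star_mul_smul (x y : leftIdeal p) :
    compressionCoeff p (star (x : B) * y) • p = star (x : B) * y :=
  (compressionCoeff_smul p _).trans (star_mul_mem_compression hp.out x y)

/-- The C*-identity gives the modulus, self-adjointness gives reality and positivity of `star x * x`
gives the sign. So the norm inherited from `B` is already the Hilbert norm, and completeness comes
from closedness of `B p`. -/
theorem compressionCoeff_star_mul_self (x : leftIdeal p) :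
    compressionCoeff p (star (x : B) * x) = ((‖x‖ ^ 2 : ℝ) : ℂ) := by
  set c := compressionCoeff p (star (x : B) * x) with hc
  have hcp : c • p = star (x : B) * x := compressionCoeff_star_mul_smul p x x
  have hnorm : ‖c‖ = ‖x‖ ^ 2 := by
    have := CStarRing.norm_star_mul_self (x := (x : B))
    rw [← hcp, norm_smul, hp.out.norm_eq_one, mul_one] at this
    rw [this, sq]
    rfl
  have hreal : star c = c := by
    have h1 : star (star (x : B) * x) = star (x : B) * x := by simp
    rw [← hcp, star_smul, hp.out.star_eq] at h1
    exact smul_left_injective ℂ hp.out.1 h1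
  obtain ⟨r, hr⟩ : ∃ r : ℝ, (r : ℂ) = c := Complex.conj_eq_iff_real.1 hreal |>.imp fun _ h => h.symm
  rw [← hr] at hnorm hcp ⊢
  rw [Complex.norm_real, Real.norm_eq_abs] at hnorm
  rcases le_or_gt 0 r with h | h
  · rw [← hnorm, abs_of_nonneg h]
  -- For `r < 0`, `-(star x * x)` equals `star w * w` with `w = √(-r) • p`, so both `star x * x` and
  -- its negative are positive.
  · have hx0 : (x : B) = 0 := by
      let _ := CStarAlgebra.spectralOrder B
      let _ := CStarAlgebra.spectralOrderedRing B
      have h1 : 0 ≤ star (x : B) * x := star_mul_self_nonneg _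
      have h2 : 0 ≤ star (((√(-r) : ℝ) : ℂ) • p) * (((√(-r) : ℝ) : ℂ) • p) := star_mul_self_nonneg _
      have h3 : star (((√(-r) : ℝ) : ℂ) • p) * (((√(-r) : ℝ) : ℂ) • p) = -(star (x : B) * x) := by
        rw [star_smul, hp.out.star_eq, smul_mul_smul_comm, hp.out.mul_self, ← hcp, ← neg_smul]
        congr 1
        rw [RCLike.star_def, Complex.conj_ofReal, ← Complex.ofReal_mul,
          Real.mul_self_sqrt (by linarith)]
        simp
      rw [h3] at h2
      exact (CStarRing.star_mul_self_eq_zero_iff _).1 (le_antisymm (neg_nonneg.1 h2) h1)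
    have : ‖x‖ = 0 := by
      change ‖(x : B)‖ = 0
      rw [hx0, norm_zero]
    rw [this] at hnorm
    rw [abs_eq_zero.1 (hnorm.trans (by norm_num)), this]
    simp

/-- For a minimal projection `p`, the left ideal `B p` is a Hilbert space with
`star x * y = ⟪x, y⟫ • p`. -/
noncomputable instance : InnerProductSpace ℂ (leftIdeal p) where
  inner x y := compressionCoeff p (star (x : B) * y)
  norm_sq_eq_re_inner x := by
    rw [compressionCoeff_star_mul_self]
    rfl
  conj_inner_symm x y := by
    symm
    refine compressionCoeff_eq ?_
    have h := congrArg star (compressionCoeff_star_mul_smul p y x)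
    rw [star_smul, hp.out.star_eq, star_mul, star_star] at h
    rw [star_mul_mem_compression hp.out, ← h]
    rfl
  add_left x y z := by
    refine compressionCoeff_eq ?_
    rw [star_mul_mem_compression hp.out, add_smul, compressionCoeff_star_mul_smul,
      compressionCoeff_star_mul_smul, Submodule.coe_add, star_add, add_mul]
  smul_left x y r := by
    refine compressionCoeff_eq ?_
    rw [star_mul_mem_compression hp.out, mul_smul, compressionCoeff_star_mul_smul,
      Submodule.coe_smul, star_smul, smul_mul_assoc]
    rfl

theorem leftIdeal_inner_smul (x y : leftIdeal p) : inner ℂ x y • p = star (x : B) * y :=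
  compressionCoeff_star_mul_smul p x y

/-- The representation of `B` by left multiplication on the Hilbert space `B p`. -/
noncomputable def leftRep : B →⋆ₙₐ[ℂ] (leftIdeal p →L[ℂ] leftIdeal p) where
  toFun := leftMulCLM p
  map_smul' c b := ContinuousLinearMap.ext fun x => Subtype.ext (smul_mul_assoc c b (x : B))
  map_zero' := ContinuousLinearMap.ext fun x => Subtype.ext (zero_mul (x : B))
  map_add' a b := ContinuousLinearMap.ext fun x => Subtype.ext (add_mul a b (x : B))
  map_mul' a b := ContinuousLinearMap.ext fun x => Subtype.ext (mul_assoc a b (x : B))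
  map_star' b := by
    refine (ContinuousLinearMap.eq_adjoint_iff _ _).2 fun x y => ?_
    refine smul_left_injective ℂ hp.out.1 ?_
    simp only [leftIdeal_inner_smul, coe_leftMulCLM]
    simp [mul_assoc]

theorem coe_leftRep (b : B) (x : leftIdeal p) : (leftRep p b x : B) = b * x := rfl

theorem leftRep_mul_star (x y : leftIdeal p) :
    leftRep p ((x : B) * star (y : B)) = rankOne ℂ x y := by
  refine ContinuousLinearMap.ext fun z => Subtype.ext ?_
  rw [coe_leftRep, mul_assoc, ← leftIdeal_inner_smul, mul_smul_comm, mem_leftIdeal.1 x.2,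
    rankOne_apply, Submodule.coe_smul]

theorem mem_generatedIdeal : p ∈ generatedIdeal p := by
  have := mul_mul_mem_generatedIdeal p p p
  rwa [hp.out.mul_self, hp.out.mul_self] at this

/-- Each generator is `x * p * y = (x * p) * star (star y * p)`, which acts on `B p` as a rank one
operator. -/
theorem generatedIdeal_le_comap_compact :
    generatedIdeal p ≤ ClosedIdeal.comap (leftRep p) (compactIdeal (leftIdeal p)) := by
  refine generatedIdeal_le p fun x y => ?_
  have h : x * p * y = (x * p) * star (star y * p) := by
    rw [star_mul, star_star, hp.out.star_eq, mul_assoc, mul_assoc, ← mul_assoc p p, hp.out.mul_self]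
  rw [ClosedIdeal.mem_comap, h, leftRep_mul_star p ⟨x * p, hp.out.mul_mem_leftIdeal x⟩
    ⟨star y * p, hp.out.mul_mem_leftIdeal (star y)⟩]
  exact isCompactOperator_rankOne _ _

/-- Such a `z` annihilates `B p`, hence the whole closed ideal generated by `p`. That ideal contains
`star z`, so `z * star z = 0`. -/
theorem eq_zero_of_leftRep_eq_zero {z : B} (hz : z ∈ generatedIdeal p) (h : leftRep p z = 0) :
    z = 0 := by
  have h1 (x : B) : z * (x * p) = 0 := by
    have := coe_leftRep p z ⟨x * p, hp.out.mul_mem_leftIdeal x⟩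
    rw [h] at this
    exact this.symm
  have h2 : (generatedIdeal p : Set B) ⊆ {w | z * w = 0} := by
    refine closure_minimal ?_ (isClosed_eq (by fun_prop) continuous_const)
    refine Submodule.span_le (p := LinearMap.ker (LinearMap.mulLeft ℂ z)).2 ?_
    rintro _ ⟨x, y, rfl⟩
    change z * (x * p * y) = 0
    rw [← mul_assoc, h1, zero_mul]
  exact (CStarRing.mul_star_self_eq_zero_iff z).1 (h2 ((generatedIdeal p).star_mem hz))

instance (I : ClosedIdeal B) : IsClosed (I.toStarSubalgebra : Set B) := I.isClosed

/-- The closed ideal generated by a minimal projection is elementary. -/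
theorem isElementary_generatedIdeal : IsElementary (generatedIdeal p).toStarSubalgebra := by
  let θ : (generatedIdeal p).toStarSubalgebra →⋆ₙₐ[ℂ] (leftIdeal p →L[ℂ] leftIdeal p) :=
    (leftRep p).comp (NonUnitalStarSubalgebraClass.subtype _)
  have hinj : Function.Injective θ := (injective_iff_map_eq_zero θ).2 fun z hz =>
    Subtype.ext (eq_zero_of_leftRep_eq_zero p z.2 hz)
  -- Injective `*`-homomorphisms are isometric. The closed range contains all rank one operators,
  -- hence all compact ones.
  have hclosed : IsClosed (Set.range θ) :=
    (NonUnitalStarAlgHom.isometry θ hinj).isClosedEmbedding.isClosed_range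
  have hsub : closure (Submodule.span ℂ {S : leftIdeal p →L[ℂ] leftIdeal p |
      ∃ x y, S = rankOne ℂ x y} : Set (leftIdeal p →L[ℂ] leftIdeal p)) ⊆ Set.range θ := by
    refine closure_minimal ?_ hclosed
    refine Submodule.span_le (p := LinearMap.range
      (θ : (generatedIdeal p).toStarSubalgebra →ₗ[ℂ] (leftIdeal p →L[ℂ] leftIdeal p))).2 ?_
    rintro _ ⟨x, y, rfl⟩
    refine ⟨⟨(x : B) * star (y : B), ?_⟩, leftRep_mul_star p x y⟩
    rw [← mem_leftIdeal.1 x.2]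
    exact mul_mul_mem_generatedIdeal p _ _
  let φ : (generatedIdeal p).toStarSubalgebra →⋆ₙₐ[ℂ]
      (compactIdeal (leftIdeal p)).toStarSubalgebra :=
    NonUnitalStarAlgHom.codRestrict θ _ fun z => generatedIdeal_le_comap_compact p z.2
  have hφ : Function.Bijective φ := by
    refine ⟨fun x y h => hinj (congrArg Subtype.val h), fun T => ?_⟩
    obtain ⟨z, hz⟩ := hsub (IsCompactOperator.mem_closure_span_rankOne
      (T := (T : leftIdeal p →L[ℂ] leftIdeal p)) T.2)
    exact ⟨z, Subtype.ext hz⟩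
  exact ⟨leftIdeal p, inferInstance, inferInstance, inferInstance, ⟨StarAlgEquiv.ofBijective φ hφ⟩⟩

end LeftIdeal

/-! ### From condition 1 to a composition series with elementary quotients. -/

section CompositionSeries

open ClosedIdeal

variable {A : Type u} [NonUnitalCStarAlgebra A]

theorem exists_elementarySeries_of_quotient
    (h : ∀ (B : Type u) [NonUnitalCStarAlgebra B] (π : A →⋆ₙₐ[ℂ] B),
      Function.Surjective π → Nontrivial B → ∃ p : B, IsMinimalProjection p) :
    ∃ (m : Ordinal.{u}) (J : Ordinal.{u} → ClosedIdeal A), IsIdealSeries m J ∧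
      ∀ α < m, IsElementary ((J (α + 1)).subquotient (J α)) := by
  classical
  have hex (I : ClosedIdeal A) (hI : I ≠ ⊤) : ∃ p : I.Quotient, IsMinimalProjection p :=
    h I.Quotient (Quotient.mkHom I) (ClosedIdeal.Quotient.mk_surjective I)
      ((ClosedIdeal.Quotient.nontrivial_iff I).2 hI)
  let D : ClosedIdeal A → ClosedIdeal A := fun I =>
    if hI : I ≠ ⊤ then comap (Quotient.mkHom I) (generatedIdeal (hex I hI).choose) else ⊤
  have hD (I : ClosedIdeal A) (hI : I ≠ ⊤) :
      D I = comap (Quotient.mkHom I) (generatedIdeal (hex I hI).choose) := dif_pos hI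
  obtain ⟨o, J, hJ, hsucc⟩ := exists_isIdealSeries D fun I hI => by
    rw [hD I hI]
    have : Fact (IsMinimalProjection (hex I hI).choose) := ⟨(hex I hI).choose_spec⟩
    exact lt_comap_mkHom I (mem_generatedIdeal _) this.out.1
  refine ⟨o, J, hJ, fun α hα => ?_⟩
  obtain ⟨hne, hs⟩ := hsucc α hα
  have : Fact (IsMinimalProjection (hex (J α) hne).choose) := ⟨(hex (J α) hne).choose_spec⟩
  have heq : (J (α + 1)).subquotient (J α) =
      (generatedIdeal (hex (J α) hne).choose).toStarSubalgebra := by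
    rw [hs, hD _ hne]
    ext x
    exact mem_subquotient_comap
  rw [heq]
  exact isElementary_generatedIdeal _

end CompositionSeries

/-! ### Countability of spectra along a composition series. -/

section CountableSpectrum

open ClosedIdeal

variable {A : Type u} [NonUnitalCStarAlgebra A]

theorem IsSelfAdjoint.countable_quasispectrum_iff {a : A} (ha : IsSelfAdjoint a) :
    (quasispectrum ℂ a).Countable ↔ (quasispectrum ℝ a).Countable := by
  rw [← ha.quasispectrumRestricts.algebraMap_image]
  exact ⟨fun h => Set.countable_of_injective_of_countable_image
    (Complex.ofReal_injective.injOn) h, fun h => h.image _⟩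

/-- The tent function supported on `[r, s]`. -/
def tent (r s x : ℝ) : ℝ := max 0 (min (x - r) (s - x))

theorem continuous_tent (r s : ℝ) : Continuous (tent r s) := by
  unfold tent
  fun_prop

theorem tent_of_notMem {r s x : ℝ} (h : ¬ (r < x ∧ x < s)) : tent r s x = 0 := by
  refine max_eq_left ?_
  by_contra! h'
  rw [lt_min_iff] at h'
  exact h ⟨by linarith, by linarith⟩

theorem eq_or_eq_of_tent {r s x : ℝ} (h : r < x ∧ x < s) :
    x = r + tent r s x ∨ x = s - tent r s x := by
  have : tent r s x = min (x - r) (s - x) :=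
    max_eq_right (le_min (by linarith) (by linarith))
  rw [this]
  rcases min_choice (x - r) (s - x) with h | h <;> rw [h]
  · left; ring
  · right; ring

/-- There are only countably many rational intervals. On `(r, s)` the tent is at most two-to-one, so
countability of the spectrum of `tent r s` applied to `a` bounds the part of the spectrum of `a` in
`(r, s)`. -/
theorem countable_quasispectrum_of_tent {a : A} (ha : IsSelfAdjoint a) {C : Set ℝ}
    (hC : C.Countable)
    (h : ∀ x ∈ quasispectrum ℝ a, x ∉ C → ∃ r s : ℚ, ((r : ℝ) < x ∧ x < s) ∧ tent r s 0 = 0 ∧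
      (quasispectrum ℝ (cfcₙ (tent r s) a)).Countable) : (quasispectrum ℝ a).Countable := by
  let G : ℚ → ℚ → Set ℝ := fun r s => {x | x ∈ quasispectrum ℝ a ∧ ((r : ℝ) < x ∧ x < s) ∧
    tent r s 0 = 0 ∧ (quasispectrum ℝ (cfcₙ (tent r s) a)).Countable}
  have hcov : quasispectrum ℝ a ⊆ C ∪ ⋃ (r : ℚ) (s : ℚ), G r s := fun x hx => by
    by_cases hxC : x ∈ C
    · exact Or.inl hxC
    · obtain ⟨r, s, h1, h2, h3⟩ := h x hx hxC
      exact Or.inr (Set.mem_iUnion₂.2 ⟨r, s, hx, h1, h2, h3⟩)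
  refine (hC.union (Set.countable_iUnion fun r => Set.countable_iUnion fun s => ?_)).mono hcov
  rcases (G r s).eq_empty_or_nonempty with he | ⟨x₀, -, -, h0, hcount⟩
  · rw [he]
    exact Set.countable_empty
  rw [cfcₙ_map_quasispectrum (R := ℝ) _ a (continuous_tent r s).continuousOn h0 ha] at hcount
  have hsub : G r s ⊆ ⋃ y ∈ tent r s '' quasispectrum ℝ a, {(r : ℝ) + y, (s : ℝ) - y} := by
    rintro x ⟨hx, hrs, -, -⟩
    refine Set.mem_iUnion₂.2 ⟨tent r s x, Set.mem_image_of_mem _ hx, ?_⟩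
    exact eq_or_eq_of_tent hrs
  exact (hcount.biUnion fun y _ => (Set.toFinite _).countable).mono hsub

/-- A point of the spectrum that is removed in a quotient by an ideal whose self-adjoint elements
have countable spectra has a neighbourhood in which the spectrum is countable. -/
theorem countable_quasispectrum_of_quotients {a : A} (ha : IsSelfAdjoint a) {C : Set ℝ}
    (hC : C.Countable)
    (h : ∀ x ∈ quasispectrum ℝ a, x ∉ C → ∃ J : ClosedIdeal A,
      (∀ b ∈ J, IsSelfAdjoint b → (quasispectrum ℝ b).Countable) ∧
      x ∉ quasispectrum ℝ (ClosedIdeal.Quotient.mk J a)) : (quasispectrum ℝ a).Countable := by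
  refine countable_quasispectrum_of_tent ha hC fun x hx hxC => ?_
  obtain ⟨J, hJ, hxJ⟩ := h x hx hxC
  have hclosed : IsClosed (quasispectrum ℝ (ClosedIdeal.Quotient.mk J a)) :=
    (NonUnitalContinuousFunctionalCalculus.isCompact_quasispectrum (R := ℝ) _).isClosed
  obtain ⟨ε, hε, hball⟩ := Metric.isOpen_iff.1 hclosed.isOpen_compl x hxJ
  obtain ⟨r, hr1, hr2⟩ := exists_rat_btwn (show x - ε < x by linarith)
  obtain ⟨s, hs1, hs2⟩ := exists_rat_btwn (show x < x + ε by linarith)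
  -- The tent is supported in the gap around `x`, so its value at `[a]` vanishes and its value at
  -- `a` lies in `J`. As `0` always belongs to a quasispectrum, this also gives the vanishing at `0`
  -- that `cfcₙ` needs.
  have hzero : ∀ y ∈ quasispectrum ℝ (ClosedIdeal.Quotient.mk J a), tent r s y = 0 := fun y hy => by
    refine tent_of_notMem fun hrs => hball ?_ hy
    rw [Metric.mem_ball, Real.dist_eq, abs_lt]
    exact ⟨by linarith, by linarith⟩
  have h0 : tent r s 0 = 0 := hzero 0 (quasispectrum.zero_mem ℝ _)
  refine ⟨r, s, ⟨hr2, hs1⟩, h0, hJ _ ?_ (cfcₙ_predicate _ _)⟩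
  rw [← ClosedIdeal.Quotient.mk_eq_zero, ← ClosedIdeal.Quotient.mkHom_apply]
  have hcont : Continuous (ClosedIdeal.Quotient.mkHom J) :=
    AddMonoidHomClass.continuous_of_bound (ClosedIdeal.Quotient.mkHom J) 1 fun x => by
      simpa using NonUnitalStarAlgHom.norm_apply_le (ClosedIdeal.Quotient.mkHom J) x
  rw [NonUnitalStarAlgHom.map_cfcₙ (ClosedIdeal.Quotient.mkHom J) (tent r s) a
    (continuous_tent r s).continuousOn h0 hcont ha (ha.map (ClosedIdeal.Quotient.mkHom J)),
    ClosedIdeal.Quotient.mkHom_apply, cfcₙ_congr (g := fun _ => 0) hzero, cfcₙ_const_zero]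

/-- At a successor, the exceptional set is the spectrum in the elementary subquotient, and the other
points vanish modulo `J β`. At a limit, only `0` is exceptional. -/
theorem countable_quasispectrum_of_elementary {o : Ordinal.{u}}
    {J : Ordinal.{u} → ClosedIdeal A} (hJ : IsIdealSeries o J)
    (hel : ∀ α < o, IsElementary ((J (α + 1)).subquotient (J α))) {a : A}
    (ha : IsSelfAdjoint a) : (quasispectrum ℂ a).Countable := by
  rw [ha.countable_quasispectrum_iff]
  suffices H : ∀ α ≤ o, ∀ b ∈ J α, IsSelfAdjoint b → (quasispectrum ℝ b).Countable by
    refine H o le_rfl a ?_ ha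
    rw [← SetLike.mem_coe, hJ.top]
    trivial
  intro α
  induction α using Ordinal.limitRecOn with
  | zero =>
    intro _ b hb _
    rw [← SetLike.mem_coe, hJ.zero] at hb
    rw [Set.mem_singleton_iff.1 hb, CFC.quasispectrum_zero_eq]
    exact Set.countable_singleton 0
  | add_one β ih =>
    intro hβ b hb hsa
    have hβo : β < o := (Order.lt_succ β).trans_le hβ
    have hsa' : IsSelfAdjoint (ClosedIdeal.Quotient.mk (J β) b) := hsa.map (ClosedIdeal.Quotient.mkHom (J β))
    refine countable_quasispectrum_of_quotients hsa (hsa'.countable_quasispectrum_iff.1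
      ((hel β hβo).countable_quasispectrum ⟨b, hb, rfl⟩ hsa')) fun x _ hx => ?_
    exact ⟨J β, ih hβo.le, hx⟩
  | limit l hl ih =>
    intro hlo b hb hsa
    refine countable_quasispectrum_of_quotients hsa (Set.countable_singleton 0) fun x _ hx => ?_
    have hx0 : 0 < |x| := abs_pos.2 hx
    rw [← SetLike.mem_coe, hJ.limit l hlo hl] at hb
    -- An earlier ideal comes within `|x|` of `b`; modulo that ideal `b` has norm below `|x|`, so
    -- `x` leaves the spectrum.
    obtain ⟨c, hc, hbc⟩ := Metric.mem_closure_iff.1 hb |x| hx0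
    obtain ⟨β, hβ, hcβ⟩ := Set.mem_iUnion₂.1 hc
    refine ⟨J β, ih β hβ (hβ.le.trans hlo), fun hmem => ?_⟩
    have hsa' : IsSelfAdjoint (ClosedIdeal.Quotient.mk (J β) b) := hsa.map (ClosedIdeal.Quotient.mkHom (J β))
    have h1 : ‖x‖ ≤ ‖ClosedIdeal.Quotient.mk (J β) b‖ :=
      NonUnitalIsometricContinuousFunctionalCalculus.norm_quasispectrum_le _ hmem hsa'
    have h2 : ClosedIdeal.Quotient.mk (J β) b = ClosedIdeal.Quotient.mk (J β) (b - c) := by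
      rw [Quotient.mk_eq_mk, sub_sub_cancel]
      exact hcβ
    have h3 := ClosedIdeal.Quotient.norm_mk_le (J β) (b - c)
    rw [dist_eq_norm] at hbc
    rw [h2, Real.norm_eq_abs] at h1
    linarith

end CountableSpectrum

/-! ### A self-adjoint element built from a binary tree of projections. -/

section SelfSimilar

/-- A bounded solution of `G x = 4⁻¹ • G (l x) + 4⁻¹ • G (r x) + e x`. -/
theorem exists_selfSimilar {X E : Type*} [NormedAddCommGroup E] [NormedSpace ℝ E]
    [CompleteSpace E] (l r : X → X) (e : X → E) (he : ∀ x, ‖e x‖ ≤ 1)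
    (V : X → Submodule ℝ E) (hV : ∀ x, IsClosed (V x : Set E)) (hl : ∀ x, V (l x) ≤ V x)
    (hr : ∀ x, V (r x) ≤ V x) (heV : ∀ x, e x ∈ V x) :
    ∃ G : X → E, (∀ x, ‖G x‖ ≤ 2) ∧ (∀ x, G x ∈ V x) ∧
      ∀ x, G x = (4⁻¹ : ℝ) • G (l x) + (4⁻¹ : ℝ) • G (r x) + e x := by
  let T : (X → E) → X → E := fun g x => (4⁻¹ : ℝ) • g (l x) + (4⁻¹ : ℝ) • g (r x) + e x
  -- Picard iteration: `T` contracts the supremum distance by `4⁻¹ + 4⁻¹ = 1 / 2`, and the bound `2`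
  -- is the fixed point of `t ↦ t / 2 + 1`.
  let g : ℕ → X → E := fun n => T^[n] 0
  have hg (n : ℕ) : g (n + 1) = T (g n) := Function.iterate_succ_apply' T n 0
  have hbound (n : ℕ) (x : X) : ‖g n x‖ ≤ 2 := by
    induction n generalizing x with
    | zero => simp [g]
    | succ n ih =>
      rw [hg]
      have h1 := norm_add₃_le (a := (4⁻¹ : ℝ) • g n (l x)) (b := (4⁻¹ : ℝ) • g n (r x)) (c := e x)
      rw [norm_smul, norm_smul, Real.norm_of_nonneg (by norm_num : (0 : ℝ) ≤ 4⁻¹)] at h1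
      have := ih (l x)
      have := ih (r x)
      have := he x
      change ‖(4⁻¹ : ℝ) • g n (l x) + (4⁻¹ : ℝ) • g n (r x) + e x‖ ≤ 2
      linarith
  have hmem (n : ℕ) (x : X) : g n x ∈ V x := by
    induction n generalizing x with
    | zero => exact (V x).zero_mem
    | succ n ih =>
      rw [hg]
      exact (V x).add_mem ((V x).add_mem ((V x).smul_mem _ (hl x (ih (l x))))
        ((V x).smul_mem _ (hr x (ih (r x))))) (heV x)
  have hdist (n : ℕ) (x : X) : dist (g n x) (g (n + 1) x) ≤ 2 * (1 / 2 : ℝ) ^ n := by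
    induction n generalizing x with
    | zero =>
      rw [pow_zero, mul_one, dist_eq_norm]
      simpa [g] using hbound 1 x
    | succ n ih =>
      have h1 : g (n + 1) x - g (n + 1 + 1) x =
          (4⁻¹ : ℝ) • (g n (l x) - g (n + 1) (l x)) + (4⁻¹ : ℝ) • (g n (r x) - g (n + 1) (r x)) := by
        rw [hg (n + 1)]
        nth_rewrite 1 [hg n]
        simp only [T, smul_sub]
        abel
      have h2 := norm_add_le ((4⁻¹ : ℝ) • (g n (l x) - g (n + 1) (l x)))
        ((4⁻¹ : ℝ) • (g n (r x) - g (n + 1) (r x)))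
      rw [norm_smul, norm_smul, Real.norm_of_nonneg (by norm_num : (0 : ℝ) ≤ 4⁻¹)] at h2
      have h3 := ih (l x)
      have h4 := ih (r x)
      rw [dist_eq_norm] at h3 h4 ⊢
      rw [h1, pow_succ]
      linarith
  have hlim (x : X) : ∃ y, Filter.Tendsto (fun n => g n x) Filter.atTop (nhds y) :=
    cauchySeq_tendsto_of_complete
      (cauchySeq_of_le_geometric (1 / 2) 2 (by norm_num) fun n => hdist n x)
  choose G hG using hlim
  refine ⟨G, fun x => le_of_tendsto (hG x).norm (Filter.Eventually.of_forall fun n => hbound n x),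
    fun x => (hV x).mem_of_tendsto (hG x) (Filter.Eventually.of_forall fun n => hmem n x),
    fun x => ?_⟩
  have h1 : Filter.Tendsto (fun n => g (n + 1) x) Filter.atTop (nhds (G x)) :=
    (hG x).comp (Filter.tendsto_add_atTop_nat 1)
  refine tendsto_nhds_unique h1 ?_
  simp only [hg]
  exact (((hG (l x)).const_smul _).add ((hG (r x)).const_smul _)).add_const _

end SelfSimilar

section ProjectionTree

variable {A : Type u} [NonUnitalCStarAlgebra A]

/-- A scalar admitting approximate eigenvectors belongs to the quasispectrum. -/
theorem mem_quasispectrum_of_tendsto {a : A} {c : ℂ} {p : ℕ → A} (hp : ∀ n, ‖p n‖ = 1)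
    (h : Filter.Tendsto (fun n => ‖a * p n - c • p n‖) Filter.atTop (nhds 0)) :
    c ∈ quasispectrum ℂ a := by
  rw [Unitization.quasispectrum_eq_spectrum_inr, spectrum.mem_iff]
  rintro ⟨w, hw⟩
  -- An inverse of `c - a` recovers the unit vector `p n` from `c • p n - a * p n`, which tends to
  -- `0`.
  have key (n : ℕ) : 1 ≤ ‖(↑w⁻¹ : Unitization ℂ A)‖ * ‖a * p n - c • p n‖ := by
    have h1 : ((p n : A) : Unitization ℂ A) =
        (↑w⁻¹ : Unitization ℂ A) * ((-(a * p n - c • p n) : A) : Unitization ℂ A) := by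
      have h2 : ((-(a * p n - c • p n) : A) : Unitization ℂ A) =
          (w : Unitization ℂ A) * ((p n : A) : Unitization ℂ A) := by
        rw [hw, sub_mul, ← Algebra.smul_def]
        simp
      rw [h2, Units.inv_mul_cancel_left]
    have h3 := norm_mul_le (↑w⁻¹ : Unitization ℂ A) ((-(a * p n - c • p n) : A) : Unitization ℂ A)
    rwa [← h1, Unitization.norm_inr, Unitization.norm_inr, norm_neg, hp] at h3
  have h4 := h.const_mul ‖(↑w⁻¹ : Unitization ℂ A)‖
  rw [mul_zero] at h4
  exact absurd (ge_of_tendsto' h4 key) (by norm_num)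

/-- An infinite binary tree of projections gives a self-adjoint element whose spectrum contains a
Cantor set. -/
theorem exists_not_countable_quasispectrum_of_tree {X : Type*} [Nonempty X] (P : X → A)
    (c : Bool → X → X) (hP : ∀ x, IsStarProjection (P x)) (h0 : ∀ x, P x ≠ 0)
    (hsum : ∀ x, P (c false x) + P (c true x) = P x)
    (hmul : ∀ x, P (c false x) * P (c true x) = 0) :
    ∃ a : A, IsSelfAdjoint a ∧ ¬ (quasispectrum ℂ a).Countable := by
  have hidem (x : X) : P x * P x = P x := (hP x).isIdempotentElem.eq
  have hstar (x : X) : star (P x) = P x := (hP x).isSelfAdjoint.star_eq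
  have hmul' (x : X) : P (c true x) * P (c false x) = 0 := by
    have := congrArg star (hmul x)
    rwa [star_mul, hstar, hstar, star_zero] at this
  have hchild (i : Bool) (x : X) : P x * P (c i x) = P (c i x) := by
    rw [← hsum x]
    cases i
    · rw [add_mul, hmul', add_zero, hidem]
    · rw [add_mul, hmul, zero_add, hidem]
  -- The self-adjoint part of the corner of `P x`. Membership of `G x` makes the two summands
  -- attached to the children of `x` live in orthogonal corners.
  let V : X → Submodule ℝ A := fun x =>
    { carrier := {y | star y = y ∧ P x * y = y}
      add_mem' := fun {y z} hy hz => ⟨by rw [star_add, hy.1, hz.1], by rw [mul_add, hy.2, hz.2]⟩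
      zero_mem' := ⟨star_zero A, mul_zero _⟩
      smul_mem' := fun t y hy =>
        ⟨by rw [star_smul, hy.1, star_trivial], by rw [mul_smul_comm, hy.2]⟩ }
  have hVc (i : Bool) (x : X) : V (c i x) ≤ V x := fun y hy =>
    ⟨hy.1, by rw [← hy.2, ← mul_assoc, hchild]⟩
  obtain ⟨G, hG2, hGV, hG⟩ := exists_selfSimilar (c false) (c true) (fun x => P (c true x))
    (fun x => ((hP _).norm_eq_one (h0 _)).le) V
    (fun x => (isClosed_eq continuous_star continuous_id).inter
      (isClosed_eq (by fun_prop) continuous_id))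
    (hVc false) (hVc true) (fun x => ⟨hstar _, hchild true x⟩)
  have hGP (x : X) : G x * P x = G x := by
    have := congrArg star (hGV x).2
    rwa [star_mul, (hGV x).1, hstar] at this
  have hGmul (i j : Bool) (x : X) (hij : P (c i x) * P (c j x) = 0) : G (c i x) * P (c j x) = 0 := by
    rw [← hGP, mul_assoc, hij, mul_zero]
  have hGc (i : Bool) (x : X) :
      G x * P (c i x) = (4⁻¹ : ℝ) • G (c i x) + (cond i 1 0 : ℝ) • P (c i x) := by
    rw [hG x]
    cases i
    · simp [add_mul, smul_mul_assoc, hGP, hGmul true false x (hmul' x), hmul']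
    · simp [add_mul, smul_mul_assoc, hGP, hGmul false true x (hmul x), hidem]
  obtain ⟨x₀⟩ := ‹Nonempty X›
  refine ⟨G x₀, (hGV x₀).1, fun hcount => ?_⟩
  have hmem (b : ℕ → Bool) :
      ((Cardinal.cantorFunction 4⁻¹ b : ℝ) : ℂ) ∈ quasispectrum ℂ (G x₀) := by
    let y : ℕ → X := fun n => Nat.rec x₀ (fun k x => c (b k) x) n
    have hy (n : ℕ) : y (n + 1) = c (b n) (y n) := rfl
    let t : ℕ → ℝ := fun n => ∑ k ∈ Finset.range n, Cardinal.cantorFunctionAux 4⁻¹ b k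
    -- Along the branch `b`, the element acts on `P (y n)` as the `n`-th partial sum of the Cantor
    -- series up to an error of size `4⁻¹ ^ n`. So the `P (y n)` are approximate eigenvectors for
    -- the full sum; the ratio `4⁻¹ < 1 / 2` makes distinct branches give distinct sums.
    have hrec (n : ℕ) : G x₀ * P (y n) = t n • P (y n) + ((4⁻¹ : ℝ) ^ n) • G (y n) := by
      induction n with
      | zero =>
        have hy0 : y 0 = x₀ := rfl
        simpa [t, hy0] using hGP x₀
      | succ n ih =>
        have h1 : P (y n) * P (y (n + 1)) = P (y (n + 1)) := hchild (b n) (y n)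
        have h2 : t (n + 1) = t n + (4⁻¹ : ℝ) ^ n * cond (b n) 1 0 := by
          simp only [t, Finset.sum_range_succ, Cardinal.cantorFunctionAux]
          cases b n <;> simp
        rw [← h1, ← mul_assoc, ih, add_mul, smul_mul_assoc, smul_mul_assoc, h1, hy, hGc, h2,
          smul_add, smul_smul, smul_smul, add_smul, pow_succ, ← hy]
        abel
    have ht : Filter.Tendsto t Filter.atTop (nhds (Cardinal.cantorFunction 4⁻¹ b)) :=
      (Cardinal.summable_cantor_function b (by norm_num) (by norm_num)).hasSum.tendsto_sum_nat
    refine mem_quasispectrum_of_tendsto (p := fun n => P (y n))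
      (fun n => (hP _).norm_eq_one (h0 _)) ?_
    have hle (n : ℕ) : ‖G x₀ * P (y n) - ((Cardinal.cantorFunction 4⁻¹ b : ℝ) : ℂ) • P (y n)‖ ≤
        |t n - Cardinal.cantorFunction 4⁻¹ b| + (4⁻¹ : ℝ) ^ n * 2 := by
      have h1 : G x₀ * P (y n) - ((Cardinal.cantorFunction 4⁻¹ b : ℝ) : ℂ) • P (y n) =
          (t n - Cardinal.cantorFunction 4⁻¹ b) • P (y n) + ((4⁻¹ : ℝ) ^ n) • G (y n) := by
        rw [hrec, sub_smul, Complex.coe_smul]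
        abel
      rw [h1]
      refine (norm_add_le _ _).trans ?_
      rw [norm_smul, norm_smul, (hP _).norm_eq_one (h0 _), mul_one, Real.norm_eq_abs,
        Real.norm_of_nonneg (by positivity)]
      gcongr
      exact hG2 _
    refine squeeze_zero (fun n => norm_nonneg _) hle ?_
    have h1 : Filter.Tendsto (fun n => |t n - Cardinal.cantorFunction 4⁻¹ b|) Filter.atTop
        (nhds 0) := by
      simpa using (ht.sub_const (Cardinal.cantorFunction 4⁻¹ b)).abs
    have h2 : Filter.Tendsto (fun n : ℕ => (4⁻¹ : ℝ) ^ n * 2) Filter.atTop (nhds 0) := by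
      simpa using (tendsto_pow_atTop_nhds_zero_of_lt_one (r := (4⁻¹ : ℝ))
        (by norm_num) (by norm_num)).mul_const 2
    simpa using h1.add h2
  have hinj : Function.Injective fun b : ℕ → Bool => ((Cardinal.cantorFunction 4⁻¹ b : ℝ) : ℂ) :=
    Complex.ofReal_injective.comp (Cardinal.cantorFunction_injective (by norm_num) (by norm_num))
  have hrange : (Set.range fun b : ℕ → Bool => ((Cardinal.cantorFunction 4⁻¹ b : ℝ) : ℂ)).Countable :=
    hcount.mono (Set.range_subset_iff.2 hmem)
  have : Countable (ℕ → Bool) := by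
    rw [← Set.countable_univ_iff]
    exact Set.countable_of_injective_of_countable_image hinj.injOn (by rwa [Set.image_univ])
  obtain ⟨f, hf⟩ := exists_surjective_nat (ℕ → Bool)
  obtain ⟨n, hn⟩ := hf fun n => !f n n
  have := congrFun hn n
  simp at this

end ProjectionTree

/-! ### Spectral projections and the existence of minimal projections. -/

section SpectralProjection

variable {A : Type u} [NonUnitalCStarAlgebra A]

/-- On a countable set containing `0`, two points are separated by a continuous function with values
in `{0, 1}` that vanishes at `0`. -/
theorem Set.Countable.exists_indicator {K : Set ℝ} (hK : K.Countable) (h0 : (0 : ℝ) ∈ K) {x y : ℝ}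
    (hxy : x ≠ y) : ∃ f : ℝ → ℝ, ContinuousOn f K ∧ f 0 = 0 ∧ (∀ z, f z = 0 ∨ f z = 1) ∧
      f x ≠ f y := by
  wlog hlt : x < y generalizing x y
  · obtain ⟨f, h1, h2, h3, h4⟩ := this hxy.symm (lt_of_le_of_ne (not_lt.1 hlt) hxy.symm)
    exact ⟨f, h1, h2, h3, h4.symm⟩
  -- A countable set misses some `r` between `x` and `y`, so indicators of half-lines ending at `r`
  -- are continuous on `K`. The half-line is then chosen to avoid `0`.
  obtain ⟨r, hr, hrK⟩ : (Set.Ioo x y \ K).Nonempty := by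
    rw [Set.nonempty_iff_ne_empty, Ne, Set.sdiff_eq_empty]
    intro hsub
    exact (Cardinal.Real.Ioo_countable_iff.1 (hK.mono hsub)).not_gt hlt
  have hr0 : r ≠ 0 := fun h => hrK (h ▸ h0)
  have hcont (s : Set ℝ) (hs : frontier s ⊆ {r}) :
      ContinuousOn (s.indicator (fun _ => (1 : ℝ))) K := by
    intro z hz
    refine ContinuousAt.continuousWithinAt ?_
    refine continuousOn_const.continuousAt_indicator ?_
    intro hz'
    exact hrK ((Set.mem_singleton_iff.1 (hs hz')) ▸ hz)
  have hval (s : Set ℝ) (z : ℝ) :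
      s.indicator (fun _ => (1 : ℝ)) z = 0 ∨ s.indicator (fun _ => (1 : ℝ)) z = 1 :=
    Set.indicator_eq_zero_or_self s _ z
  rcases lt_or_gt_of_ne hr0 with h | h
  · refine ⟨(Set.Iio r).indicator fun _ => 1, hcont _ (by simp), ?_, hval _, ?_⟩
    · simp [h.le]
    · simp [hr.1, hr.2.le]
  · refine ⟨(Set.Ioi r).indicator fun _ => 1, hcont _ (by simp), ?_, hval _, ?_⟩
    · simp [h.le]
    · simp [hr.1.le, hr.2]

theorem isStarProjection_cfcₙ {a : A} {f : ℝ → ℝ} (hf : ContinuousOn f (quasispectrum ℝ a))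
    (h0 : f 0 = 0) (h01 : ∀ z, f z = 0 ∨ f z = 1) : IsStarProjection (cfcₙ f a) := by
  refine ⟨?_, cfcₙ_predicate _ _⟩
  rw [IsIdempotentElem, ← cfcₙ_mul f f a hf h0 hf h0]
  refine cfcₙ_congr fun z _ => ?_
  rcases h01 z with h | h <;> simp [h]

theorem cfcₙ_mem_of_isClosed {S : NonUnitalStarSubalgebra ℂ A} (hS : IsClosed (S : Set A)) {a : A}
    (ha : a ∈ S) (f : ℝ → ℝ) : cfcₙ f a ∈ S := by
  have : IsClosed (S : Set A) := hS
  exact cfcₙ_mem (𝕜' := ℂ) (s := S) f ha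

/-- The corner `p A p`. -/
def corner {p : A} (hp : IsSelfAdjoint p) : NonUnitalStarSubalgebra ℂ A where
  carrier := {x | p * x = x ∧ x * p = x}
  add_mem' {x y} hx hy := ⟨by rw [mul_add, hx.1, hy.1], by rw [add_mul, hx.2, hy.2]⟩
  zero_mem' := ⟨mul_zero p, zero_mul p⟩
  mul_mem' {x y} hx hy := ⟨by rw [← mul_assoc, hx.1], by rw [mul_assoc, hy.2]⟩
  smul_mem' c x hx := ⟨by rw [mul_smul_comm, hx.1], by rw [smul_mul_assoc, hx.2]⟩
  star_mem' {x} hx := ⟨by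
      have := congrArg star hx.2
      rwa [star_mul, hp.star_eq] at this, by
      have := congrArg star hx.1
      rwa [star_mul, hp.star_eq] at this⟩

theorem isClosed_corner {p : A} (hp : IsSelfAdjoint p) : IsClosed (corner hp : Set A) :=
  (isClosed_eq (by fun_prop) continuous_id).inter (isClosed_eq (by fun_prop) continuous_id)

theorem exists_isStarProjection_of_countable {S : NonUnitalStarSubalgebra ℂ A}
    (hS : IsClosed (S : Set A)) {a : A} (haS : a ∈ S) (ha : IsSelfAdjoint a) (ha0 : a ≠ 0)
    (hcount : (quasispectrum ℝ a).Countable) : ∃ p ∈ S, IsStarProjection p ∧ p ≠ 0 := by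
  obtain ⟨x, hx, hx0⟩ : ∃ x ∈ quasispectrum ℝ a, x ≠ 0 := by
    by_contra! h
    exact ha0 (CFC.eq_zero_of_quasispectrum_eq_zero (R := ℝ) a (fun x hx => h x hx) ha)
  obtain ⟨f, hf, hf0, hf01, hne⟩ := hcount.exists_indicator (quasispectrum.zero_mem ℝ a) hx0
  refine ⟨cfcₙ f a, cfcₙ_mem_of_isClosed hS haS f, isStarProjection_cfcₙ hf hf0 hf01, fun h => ?_⟩
  rw [← cfcₙ_const_zero ℝ a] at h
  have := eqOn_of_cfcₙ_eq_cfcₙ h ha hf hf0 (by fun_prop) rfl hx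
  exact hne (by rw [this, hf0])

/-- If a nonzero projection is not minimal in a subalgebra whose self-adjoint elements have countable
spectra, then it has a proper nonzero subprojection there. -/
theorem exists_subprojection {S : NonUnitalStarSubalgebra ℂ A} (hS : IsClosed (S : Set A))
    (hcount : ∀ a ∈ S, IsSelfAdjoint a → (quasispectrum ℝ a).Countable) {p : A} (hpS : p ∈ S)
    (hp : IsStarProjection p) {b : A} (hbS : b ∈ S) (hb : ∀ c : ℂ, p * b * p ≠ c • p) :
    ∃ q ∈ S, IsStarProjection q ∧ q ≠ 0 ∧ q ≠ p ∧ p * q = q ∧ q * p = q := by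
  wlog hbsa : IsSelfAdjoint b generalizing b
  · have hre : ((realPart b : A)) ∈ S := by
      rw [realPart_apply_coe]
      have h := SMulMemClass.smul_mem (s := S) ((2⁻¹ : ℝ) : ℂ) (add_mem hbS (star_mem hbS))
      rwa [Complex.coe_smul] at h
    have him : ((imaginaryPart b : A)) ∈ S := by
      rw [imaginaryPart_apply_coe]
      have h := SMulMemClass.smul_mem (s := S) ((2⁻¹ : ℝ) : ℂ) (sub_mem hbS (star_mem hbS))
      rw [Complex.coe_smul] at h
      exact SMulMemClass.smul_mem _ h
    by_cases h1 : ∀ c : ℂ, p * (realPart b : A) * p ≠ c • p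
    · exact this hre h1 (realPart b).2
    by_cases h2 : ∀ c : ℂ, p * (imaginaryPart b : A) * p ≠ c • p
    · exact this him h2 (imaginaryPart b).2
    push Not at h1 h2
    obtain ⟨c, hc⟩ := h1
    obtain ⟨d, hd⟩ := h2
    refine absurd ?_ (hb (c + Complex.I * d))
    conv_lhs => rw [← realPart_add_I_smul_imaginaryPart b]
    rw [mul_add, add_mul, hc, mul_smul_comm, smul_mul_assoc, hd, smul_smul, add_smul]
  set a := p * b * p with ha_def
  have hpp : p * p = p := hp.isIdempotentElem.eq
  have haS : a ∈ S := mul_mem (mul_mem hpS hbS) hpS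
  have ha : IsSelfAdjoint a := by
    rw [IsSelfAdjoint, ha_def, star_mul, star_mul, hbsa.star_eq, hp.isSelfAdjoint.star_eq, mul_assoc]
  have hac : a ∈ corner hp.isSelfAdjoint :=
    ⟨by rw [ha_def, ← mul_assoc, ← mul_assoc, hpp], by rw [ha_def, mul_assoc, hpp]⟩
  have ha0 : a ≠ 0 := by simpa using hb 0
  have hproj (f : ℝ → ℝ) (hf : ContinuousOn f (quasispectrum ℝ a)) (hf0 : f 0 = 0)
      (hf01 : ∀ z, f z = 0 ∨ f z = 1) {x : ℝ} (hx : x ∈ quasispectrum ℝ a) (hx1 : f x = 1)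
      (hne : cfcₙ f a ≠ p) :
      ∃ q ∈ S, IsStarProjection q ∧ q ≠ 0 ∧ q ≠ p ∧ p * q = q ∧ q * p = q := by
    refine ⟨cfcₙ f a, cfcₙ_mem_of_isClosed hS haS f, isStarProjection_cfcₙ hf hf0 hf01, fun h => ?_,
      hne, cfcₙ_mem_of_isClosed (isClosed_corner hp.isSelfAdjoint) hac f⟩
    rw [← cfcₙ_const_zero ℝ a] at h
    have := eqOn_of_cfcₙ_eq_cfcₙ h ha hf hf0 (by fun_prop) rfl hx
    rw [hx1] at this
    exact one_ne_zero this
  obtain ⟨x, hx, hx0⟩ : ∃ x ∈ quasispectrum ℝ a, x ≠ 0 := by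
    by_contra! h
    exact ha0 (CFC.eq_zero_of_quasispectrum_eq_zero (R := ℝ) a (fun x hx => h x hx) ha)
  have hK := hcount a haS ha
  -- If `x` is the only nonzero spectral value, then `a = x • cfcₙ f a`, and `cfcₙ f a = p` would
  -- make `p * b * p` a multiple of `p`. Otherwise `f` separates two nonzero values, whereas `cfcₙ f
  -- a = p` would force `f = 1` at both because `p * a = a`.
  by_cases hone : ∀ y ∈ quasispectrum ℝ a, y ≠ 0 → y = x
  · obtain ⟨f, hf, hf0, hf01, hne⟩ := hK.exists_indicator (quasispectrum.zero_mem ℝ a) hx0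
    rw [hf0] at hne
    have hfx : f x = 1 := (hf01 x).resolve_left hne
    refine hproj f hf hf0 hf01 hx hfx fun h => hb (x : ℂ) ?_
    rw [← h, Complex.coe_smul, ← cfcₙ_const_mul x f a hf hf0]
    conv_lhs => rw [← cfcₙ_id' ℝ a ha]
    refine cfcₙ_congr fun y hy => ?_
    by_cases hy0 : y = 0
    · simp [hy0, hf0]
    · rw [hone y hy hy0, hfx, mul_one]
  · push Not at hone
    obtain ⟨y, hy, hy0, hyx⟩ := hone
    obtain ⟨f, hf, hf0, hf01, hne⟩ := hK.exists_indicator (quasispectrum.zero_mem ℝ a) hyx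
    have hnep : cfcₙ f a ≠ p := by
      intro h
      have h1 : cfcₙ (fun z : ℝ => f z * z) a = cfcₙ (fun z : ℝ => z) a := by
        rw [cfcₙ_mul f (fun z => z) a hf hf0 (by fun_prop) rfl, cfcₙ_id' ℝ a ha, h, hac.1]
      have h2 := eqOn_of_cfcₙ_eq_cfcₙ h1 ha (hf.mul continuousOn_id) (by simp) (by fun_prop) rfl
      have hfy : f y = 1 := by simpa [hy0] using h2 hy
      have hfx : f x = 1 := by simpa [hx0] using h2 hx
      exact hne (hfy.trans hfx.symm)
    rcases hf01 x with h | h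
    · refine hproj f hf hf0 hf01 hy ((hf01 y).resolve_left fun h' => hne (h'.trans h.symm)) hnep
    · exact hproj f hf hf0 hf01 hx h hnep

/-- If no projection of `S` were minimal, each nonzero one would split as `q + (p - q)`. Choosing
such splittings gives a binary tree and an uncountable spectrum. -/
theorem exists_isMinimalProjection_of_countable
    (hcount : ∀ a : A, IsSelfAdjoint a → (quasispectrum ℂ a).Countable)
    {S : NonUnitalStarSubalgebra ℂ A} (hS : IsClosed (S : Set A)) (hS0 : S ≠ ⊥) :
    ∃ p : S, IsMinimalProjection p := by
  have hcount' (a : A) (_ : a ∈ S) (ha : IsSelfAdjoint a) : (quasispectrum ℝ a).Countable :=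
    ha.countable_quasispectrum_iff.1 (hcount a ha)
  by_contra! hno
  let X := {p : A // p ∈ S ∧ IsStarProjection p ∧ p ≠ 0}
  have hX : Nonempty X := by
    obtain ⟨b, hbS, hb0⟩ : ∃ b ∈ S, b ≠ 0 := by
      by_contra! h
      exact hS0 (eq_bot_iff.2 fun x hx => by simp [h x hx])
    obtain ⟨p, hpS, hp, hp0⟩ := exists_isStarProjection_of_countable hS
      (mul_mem (star_mem hbS) hbS) (IsSelfAdjoint.star_mul_self b)
      (fun h => hb0 ((CStarRing.star_mul_self_eq_zero_iff b).1 h))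
      (hcount' _ (mul_mem (star_mem hbS) hbS) (IsSelfAdjoint.star_mul_self b))
    exact ⟨p, hpS, hp, hp0⟩
  have hsplit (p : X) : ∃ q r : X, q.1 + r.1 = p.1 ∧ q.1 * r.1 = 0 := by
    obtain ⟨p, hpS, hp, hp0⟩ := p
    obtain ⟨b, hbS, hb⟩ : ∃ b ∈ S, ∀ c : ℂ, p * b * p ≠ c • p := by
      by_contra! h
      refine hno ⟨p, hpS⟩ (isMinimalProjection_iff.2 ⟨fun h0 => hp0 (congrArg Subtype.val h0),
        ⟨Subtype.ext hp.isIdempotentElem.eq, Subtype.ext hp.isSelfAdjoint.star_eq⟩, fun b => ?_⟩)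
      obtain ⟨c, hc⟩ := h b b.2
      exact ⟨c, Subtype.ext hc⟩
    obtain ⟨q, hqS, hq, hq0, hqp, hpq, hqp'⟩ := exists_subprojection hS hcount' hpS hp hbS hb
    have hqq : q * q = q := hq.isIdempotentElem.eq
    refine ⟨⟨q, hqS, hq, hq0⟩, ⟨p - q, sub_mem hpS hqS, ⟨?_, ?_⟩, sub_ne_zero.2 hqp.symm⟩,
      by simp, ?_⟩
    · rw [IsIdempotentElem, mul_sub, sub_mul, sub_mul, hp.isIdempotentElem.eq, hqq, hqp', hpq,
        sub_self, sub_zero]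
    · exact hp.isSelfAdjoint.sub hq.isSelfAdjoint
    · rw [mul_sub, hqp', hqq, sub_self]
  choose q r hsum hmul using hsplit
  obtain ⟨a, ha, hunc⟩ := exists_not_countable_quasispectrum_of_tree (fun x : X => x.1)
    (fun i => cond i r q) (fun x => x.2.2.1) (fun x => x.2.2.2) hsum hmul
  exact hunc (hcount a ha)

/-- A self-adjoint element of the image lifts to a self-adjoint one, the real part of any lift, and
homomorphisms shrink spectra. -/
theorem countable_quasispectrum_of_surjective {B : Type u} [NonUnitalCStarAlgebra B]
    (hcount : ∀ a : A, IsSelfAdjoint a → (quasispectrum ℂ a).Countable) {π : A →⋆ₙₐ[ℂ] B}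
    (hπ : Function.Surjective π) (b : B) (hb : IsSelfAdjoint b) :
    (quasispectrum ℂ b).Countable := by
  obtain ⟨a, rfl⟩ := hπ b
  have h : π (realPart a : A) = π a := by
    rw [realPart_apply_coe, ← Complex.coe_smul, map_smul, map_add, map_star, hb.star_eq,
      Complex.coe_smul, ← two_smul ℝ, smul_smul]
    norm_num
  rw [← h]
  exact (hcount _ (realPart a).2).mono (NonUnitalAlgHom.quasispectrum_apply_subset π _)

theorem exists_isMinimalProjection_of_countable_of_surjective {B : Type u}
    [NonUnitalCStarAlgebra B] [Nontrivial B]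
    (hcount : ∀ a : A, IsSelfAdjoint a → (quasispectrum ℂ a).Countable) {π : A →⋆ₙₐ[ℂ] B}
    (hπ : Function.Surjective π) : ∃ p : B, IsMinimalProjection p := by
  obtain ⟨p, hp⟩ := exists_isMinimalProjection_of_countable
    (countable_quasispectrum_of_surjective hcount hπ) (S := ⊤) isClosed_univ (by
      obtain ⟨b, hb⟩ := exists_ne (0 : B)
      intro h
      have hmem : b ∈ (⊤ : NonUnitalStarSubalgebra ℂ B) := trivial
      rw [h] at hmem
      exact hb (NonUnitalStarAlgebra.mem_bot.1 hmem))
  exact ⟨p, hp.of_ideal (S := ⊤) fun _ _ _ => NonUnitalStarAlgebra.mem_top⟩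

end SpectralProjection

/-! ### Copies of `C₀((0, 1])` and uncountable spectra. -/

section HalfOpenInterval

open Filter Topology

/-- `(0, 1]` is not compact. -/
instance : NoncompactSpace (Set.Ioc (0 : ℝ) 1) := by
  rw [← not_compactSpace_iff, ← isCompact_iff_compactSpace]
  intro h
  have := h.isClosed.closure_eq
  rw [closure_Ioc zero_ne_one] at this
  have h0 : (0 : ℝ) ∈ Set.Ioc (0 : ℝ) 1 := this ▸ Set.left_mem_Icc.2 zero_le_one
  exact lt_irrefl _ h0.1

instance : PreconnectedSpace (Set.Ioc (0 : ℝ) 1) :=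
  Subtype.preconnectedSpace isPreconnected_Ioc

/-- On the connected space `(0, 1]` a nonzero idempotent function is constantly `1`, which does not
vanish at infinity since the space is not compact. -/
theorem eq_zero_of_isIdempotentElem {f : C₀(Set.Ioc (0 : ℝ) 1, ℂ)} (hf : f * f = f) : f = 0 := by
  by_contra hne
  obtain ⟨x₀, hx₀⟩ : ∃ x, f x ≠ 0 := by
    by_contra! h
    exact hne (ZeroAtInftyContinuousMap.ext h)
  have h01 (x : Set.Ioc (0 : ℝ) 1) : f x = 0 ∨ f x = 1 := by
    have : f x * f x = f x := DFunLike.congr_fun hf x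
    rcases eq_or_ne (f x) 0 with h | h
    · exact Or.inl h
    · exact Or.inr ((mul_eq_left₀ h).1 this)
  have hclopen : IsClopen {x | f x = 1} := by
    refine ⟨isClosed_eq (map_continuous f) continuous_const, ?_⟩
    have : {x | f x = 1} = {x | f x ≠ 0} := by
      ext x
      rcases h01 x with h | h <;> simp [h]
    rw [this]
    exact isOpen_ne_fun (map_continuous f) continuous_const
  have huniv := hclopen.eq_univ ⟨x₀, (h01 x₀).resolve_left hx₀⟩
  have hone (x) : f x = 1 := by
    have : x ∈ {x | f x = 1} := huniv ▸ Set.mem_univ x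
    exact this
  have hlim : Tendsto f (cocompact _) (𝓝 0) := zero_at_infty f
  have hlim1 : Tendsto f (cocompact _) (𝓝 1) := by
    rw [show (f : Set.Ioc (0 : ℝ) 1 → ℂ) = fun _ => 1 from funext hone]
    exact tendsto_const_nhds
  exact zero_ne_one (tendsto_nhds_unique hlim hlim1)

theorem not_exists_injective_of_subalgebras {A : Type u} [NonUnitalCStarAlgebra A]
    (h : ∀ S : NonUnitalStarSubalgebra ℂ A, IsClosed (S : Set A) → S ≠ ⊥ →
      ∃ p : S, IsMinimalProjection p) :
    ¬ ∃ φ : C₀(Set.Ioc (0 : ℝ) 1, ℂ) →⋆ₙₐ[ℂ] A, Function.Injective φ := by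
  rintro ⟨φ, hφ⟩
  have hzero (f : C₀(Set.Ioc (0 : ℝ) 1, ℂ)) (hf : φ f * φ f = φ f) : φ f = 0 := by
    rw [← map_mul] at hf
    rw [eq_zero_of_isIdempotentElem (hφ hf), map_zero]
  obtain ⟨f, hf⟩ : ∃ f : C₀(Set.Ioc (0 : ℝ) 1, ℂ), f ≠ 0 := by
    let g : C₀(Set.Ioc (0 : ℝ) 1, ℂ) :=
      { toFun := fun x => ((x : ℝ) : ℂ)
        continuous_toFun := by fun_prop
        zero_at_infty' := by
          have h1 : Tendsto (fun x : Set.Ioc (0 : ℝ) 1 => (x : ℝ)) (cocompact _) (𝓝 0) := by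
            rw [Metric.tendsto_nhds]
            intro ε hε
            have hK : IsCompact {x : Set.Ioc (0 : ℝ) 1 | ε ≤ x} := by
              rw [Subtype.isCompact_iff]
              have : Subtype.val '' {x : Set.Ioc (0 : ℝ) 1 | ε ≤ x} = Set.Icc ε 1 := by
                ext t
                constructor
                · rintro ⟨x, hx, rfl⟩
                  exact ⟨hx, x.2.2⟩
                · intro ht
                  exact ⟨⟨t, hε.trans_le ht.1, ht.2⟩, ht.1, rfl⟩
              rw [this]
              exact isCompact_Icc
            filter_upwards [hK.compl_mem_cocompact] with x hx
            have : (x : ℝ) < ε := not_le.1 hx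
            rwa [Real.dist_eq, sub_zero, abs_of_pos x.2.1]
          exact (Complex.continuous_ofReal.tendsto' 0 0 rfl).comp h1 }
    refine ⟨g, fun h => ?_⟩
    have h1 : g ⟨1, by norm_num, le_rfl⟩ = 0 := by rw [h]; rfl
    simp [g] at h1
  obtain ⟨p, hp⟩ := h (NonUnitalStarAlgHom.range φ)
    (by
      have := (NonUnitalStarAlgHom.isometry φ hφ).isClosedEmbedding.isClosed_range
      exact this)
    (fun hbot => by
      have hmem : φ f ∈ NonUnitalStarAlgHom.range φ := ⟨f, rfl⟩
      rw [hbot, NonUnitalStarAlgebra.mem_bot] at hmem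
      exact hf (hφ (hmem.trans (map_zero φ).symm)))
  obtain ⟨⟨_, g, rfl⟩, hp⟩ : ∃ p : NonUnitalStarAlgHom.range φ, IsMinimalProjection p := ⟨p, hp⟩
  exact hp.1 (Subtype.ext (hzero g (congrArg Subtype.val hp.2.1.isIdempotentElem.eq)))

/-- The extension by zero of a function in `C₀((0, 1])`, made constant on `[1, ∞)`. -/
noncomputable def extendIoc (h : C₀(Set.Ioc (0 : ℝ) 1, ℂ)) (t : ℝ) : ℂ :=
  if ht : 0 < t then h ⟨min t 1, lt_min ht one_pos, min_le_right t 1⟩ else 0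

theorem extendIoc_zero (h : C₀(Set.Ioc (0 : ℝ) 1, ℂ)) : extendIoc h 0 = 0 := dif_neg (lt_irrefl 0)

theorem extendIoc_coe (h : C₀(Set.Ioc (0 : ℝ) 1, ℂ)) (x : Set.Ioc (0 : ℝ) 1) :
    extendIoc h x = h x := by
  rw [extendIoc, dif_pos x.2.1]
  congr 1
  exact Subtype.ext (min_eq_left x.2.2)

theorem continuous_extendIoc (h : C₀(Set.Ioc (0 : ℝ) 1, ℂ)) : Continuous (extendIoc h) := by
  rw [continuous_iff_continuousAt]
  intro t
  rcases lt_trichotomy t 0 with ht | rfl | ht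
  · refine continuousAt_const (y := (0 : ℂ)) |>.congr ?_
    filter_upwards [Iio_mem_nhds ht] with s hs
    rw [extendIoc, dif_neg (not_lt.2 (le_of_lt (Set.mem_Iio.1 hs)))]
  · rw [ContinuousAt, extendIoc_zero, Metric.tendsto_nhds]
    intro ε hε
    have hlim : Tendsto h (cocompact _) (𝓝 0) := zero_at_infty h
    -- `K` is compact in `(0, 1]`, hence closed in `ℝ`, and it misses `0`. Near `0` the function is
    -- therefore evaluated outside `K`.
    obtain ⟨K, hK, hKε⟩ := mem_cocompact.1 (Metric.tendsto_nhds.1 hlim ε hε)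
    have hKc : IsClosed (Subtype.val '' K : Set ℝ) := (hK.image continuous_subtype_val).isClosed
    have h0 : (0 : ℝ) ∉ (Subtype.val '' K : Set ℝ) := by
      rintro ⟨x, -, hx⟩
      exact x.2.1.ne' hx
    filter_upwards [hKc.isOpen_compl.mem_nhds h0, Iio_mem_nhds (one_pos (α := ℝ))] with s hs hs1
    by_cases hs0 : 0 < s
    · have hx := extendIoc_coe h ⟨s, hs0, le_of_lt hs1⟩
      rw [show extendIoc h s = _ from hx]
      exact hKε fun hmem => hs ⟨_, hmem, rfl⟩
    · rw [extendIoc, dif_neg hs0, dist_self]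
      exact hε
  · have hopen : IsOpen (Set.Ioi (0 : ℝ)) := isOpen_Ioi
    refine ContinuousOn.continuousAt ?_ (hopen.mem_nhds ht)
    rw [continuousOn_iff_continuous_domRestrict]
    have : (Set.Ioi (0 : ℝ)).domRestrict (extendIoc h) = fun s : Set.Ioi (0 : ℝ) =>
        h ⟨min s 1, lt_min s.2 one_pos, min_le_right _ 1⟩ := by
      funext s
      exact dif_pos s.2
    rw [this]
    exact (map_continuous h).comp (by fun_prop)

/-- A self-adjoint element with spectrum `[0, 1]` generates a copy of `C₀((0, 1])`. -/
theorem exists_injective_of_quasispectrum_eq_Icc {A : Type u} [NonUnitalCStarAlgebra A] {b : A}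
    (hb : IsSelfAdjoint b) (hspec : quasispectrum ℝ b = Set.Icc 0 1) :
    ∃ φ : C₀(Set.Ioc (0 : ℝ) 1, ℂ) →⋆ₙₐ[ℂ] A, Function.Injective φ := by
  have hcont (h : C₀(Set.Ioc (0 : ℝ) 1, ℂ)) :
      ContinuousOn (fun z : ℂ => extendIoc h z.re) (quasispectrum ℂ b) :=
    ((continuous_extendIoc h).comp Complex.continuous_re).continuousOn
  have h0 (h : C₀(Set.Ioc (0 : ℝ) 1, ℂ)) : extendIoc h (0 : ℂ).re = 0 := extendIoc_zero h
  have hnormal : IsStarNormal b := hb.isStarNormal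
  have hadd (f g : C₀(Set.Ioc (0 : ℝ) 1, ℂ)) (t : ℝ) :
      extendIoc (f + g) t = extendIoc f t + extendIoc g t := by
    unfold extendIoc
    split_ifs <;> simp
  have hmul (f g : C₀(Set.Ioc (0 : ℝ) 1, ℂ)) (t : ℝ) :
      extendIoc (f * g) t = extendIoc f t * extendIoc g t := by
    unfold extendIoc
    split_ifs <;> simp
  have hsmul (c : ℂ) (f : C₀(Set.Ioc (0 : ℝ) 1, ℂ)) (t : ℝ) :
      extendIoc (c • f) t = c * extendIoc f t := by
    unfold extendIoc
    split_ifs <;> simp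
  have hstar (f : C₀(Set.Ioc (0 : ℝ) 1, ℂ)) (t : ℝ) :
      extendIoc (star f) t = star (extendIoc f t) := by
    unfold extendIoc
    split_ifs <;> simp
  let φ : C₀(Set.Ioc (0 : ℝ) 1, ℂ) →⋆ₙₐ[ℂ] A :=
    { toFun := fun h => cfcₙ (fun z : ℂ => extendIoc h z.re) b
      map_smul' := fun c f => by
        simp only [hsmul]
        exact cfcₙ_const_mul c _ b (hcont f) (h0 f)
      map_zero' := by
        have : (fun z : ℂ => extendIoc 0 z.re) = fun _ => 0 := by
          funext z
          unfold extendIoc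
          split_ifs <;> simp
        rw [this, cfcₙ_const_zero]
      map_add' := fun f g => by
        simp only [hadd]
        exact cfcₙ_add _ _ b (hcont f) (h0 f) (hcont g) (h0 g)
      map_mul' := fun f g => by
        simp only [hmul]
        exact cfcₙ_mul _ _ b (hcont f) (h0 f) (hcont g) (h0 g)
      map_star' := fun f => by
        simp only [hstar]
        exact cfcₙ_star _ b }
  refine ⟨φ, fun f g hfg => ZeroAtInftyContinuousMap.ext fun x => ?_⟩
  have hx : ((x : ℝ) : ℂ) ∈ quasispectrum ℂ b := by
    rw [← hb.quasispectrumRestricts.algebraMap_image, hspec]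
    exact ⟨x, ⟨x.2.1.le, x.2.2⟩, rfl⟩
  have := eqOn_of_cfcₙ_eq_cfcₙ (R := ℂ) hfg hnormal (hcont f) (h0 f) (hcont g) (h0 g) hx
  simpa [extendIoc_coe] using this

/-- An uncountable closed set of reals is mapped onto `[0, 1]` by a continuous function that
vanishes at `0`. -/
theorem IsClosed.exists_image_eq_Icc {K : Set ℝ} (hK : IsClosed K)
    (hunc : ¬ K.Countable) : ∃ f : ℝ → ℝ, Continuous f ∧ f 0 = 0 ∧ f '' K = Set.Icc 0 1 := by
  -- Staying at distance at least `1 / (n + 1)` from `0` leaves room to force `f 0 = 0` without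
  -- touching the chosen part of `K`.
  obtain ⟨n, hn⟩ : ∃ n : ℕ, ¬ (K ∩ {x | 1 ≤ |x| * ((n : ℝ) + 1)}).Countable := by
    by_contra! h
    refine hunc (((Set.countable_singleton 0).union (Set.countable_iUnion h)).mono fun x hx => ?_)
    by_cases hx0 : x = 0
    · exact Or.inl hx0
    · obtain ⟨n, hn⟩ := exists_nat_one_div_lt (abs_pos.2 hx0)
      refine Or.inr (Set.mem_iUnion.2 ⟨n, hx, ?_⟩)
      rw [div_lt_iff₀ (by positivity)] at hn
      exact hn.le
  have hclosed : IsClosed (K ∩ {x | 1 ≤ |x| * ((n : ℝ) + 1)}) :=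
    hK.inter (_root_.isClosed_le continuous_const (by fun_prop))
  obtain ⟨g, hgK, hg, hginj⟩ := hclosed.exists_nat_bool_injection_of_not_countable hn
  obtain ⟨s, hs, hsurj⟩ := exists_nat_bool_continuous_surjective_of_compact unitInterval
  have hemb : IsClosedEmbedding g := hg.isClosedEmbedding hginj
  -- The uncountable closed set contains a Cantor set, which maps onto `[0, 1]`. Tietze extends this
  -- map to `ℝ`; the cut-off factor below is `1` on the Cantor set and `0` at `0`.
  obtain ⟨F, hF⟩ := ContinuousMap.exists_extension hemb (⟨s, hs⟩ : C(ℕ → Bool, unitInterval))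
  have hFg (c : ℕ → Bool) : F (g c) = s c := DFunLike.congr_fun hF c
  refine ⟨fun x => (F x : ℝ) * min 1 (|x| * ((n : ℝ) + 1)), by fun_prop, by simp, ?_⟩
  refine Set.Subset.antisymm ?_ fun t ht => ?_
  · rintro _ ⟨x, -, rfl⟩
    have h1 := (F x).2
    have h2 : 0 ≤ min 1 (|x| * ((n : ℝ) + 1)) := le_min zero_le_one (by positivity)
    exact ⟨mul_nonneg h1.1 h2, mul_le_one₀ h1.2 h2 (min_le_left _ _)⟩
  · obtain ⟨c, hc⟩ := hsurj ⟨t, ht⟩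
    have hgc := hgK (Set.mem_range_self c)
    refine ⟨g c, hgc.1, ?_⟩
    have h1 : min 1 (|g c| * ((n : ℝ) + 1)) = 1 := min_eq_left hgc.2
    simp only [h1, hFg, hc, mul_one]

theorem countable_quasispectrum_of_not_exists_injective {A : Type u} [NonUnitalCStarAlgebra A]
    (h : ¬ ∃ φ : C₀(Set.Ioc (0 : ℝ) 1, ℂ) →⋆ₙₐ[ℂ] A, Function.Injective φ) {a : A}
    (ha : IsSelfAdjoint a) : (quasispectrum ℂ a).Countable := by
  rw [ha.countable_quasispectrum_iff]
  by_contra hunc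
  have hclosed : IsClosed (quasispectrum ℝ a) :=
    (NonUnitalContinuousFunctionalCalculus.isCompact_quasispectrum (R := ℝ) _).isClosed
  obtain ⟨f, hf, hf0, hfK⟩ := hclosed.exists_image_eq_Icc hunc
  refine h (exists_injective_of_quasispectrum_eq_Icc (b := cfcₙ f a) (cfcₙ_predicate _ _) ?_)
  rw [cfcₙ_map_quasispectrum f a hf.continuousOn hf0 ha, hfK]

end HalfOpenInterval

theorem theorem1p3 (A : Type u) [NonUnitalCStarAlgebra A] :
    List.TFAE [
      -- every nonzero `*`-homomorphic image has a minimal projection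
      ∀ (B : Type u) [NonUnitalCStarAlgebra B] (π : A →⋆ₙₐ[ℂ] B),
        Function.Surjective π → Nontrivial B → ∃ p : B, IsMinimalProjection p,
      -- there is a Cantor-Bendixson sequence
      ∃ (ht : Ordinal.{u}) (I : Ordinal.{u} → ClosedIdeal A), IsIdealSeries ht I ∧
        ∀ α < ht, (atomicIdeal (I α).Quotient : Set (I α).Quotient) =
          {x | ∃ a ∈ I (α + 1), ClosedIdeal.Quotient.mk (I α) a = x},
      -- there is a composition series with elementary quotients
      ∃ (m : Ordinal.{u}) (J : Ordinal.{u} → ClosedIdeal A), IsIdealSeries m J ∧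
        ∀ α < m, IsElementary ((J (α + 1)).subquotient (J α)),
      -- every nonzero `C^*`-subalgebra has a minimal projection
      ∀ S : NonUnitalStarSubalgebra ℂ A, IsClosed (S : Set A) → S ≠ ⊥ →
        ∃ p : S, IsMinimalProjection p,
      -- there is no copy of `C_0((0,1])` in `A`
      ¬ ∃ φ : C₀(Set.Ioc (0 : ℝ) 1, ℂ) →⋆ₙₐ[ℂ] A, Function.Injective φ,
      -- self-adjoint elements have countable spectrum
      ∀ a : A, IsSelfAdjoint a → (quasispectrum ℂ a).Countable] := by
  tfae_have 1 → 2 := fun h => exists_cantorBendixson_of_quotient h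
  tfae_have 2 → 1 := by
    rintro ⟨o, I, hI, hat⟩ B _ π hπ _
    exact exists_isMinimalProjection_of_cantorBendixson hI hat hπ
  tfae_have 1 → 3 := fun h => exists_elementarySeries_of_quotient h
  tfae_have 3 → 6 := by
    rintro ⟨o, J, hJ, hel⟩ a ha
    exact countable_quasispectrum_of_elementary hJ hel ha
  tfae_have 6 → 4 := fun h S hS hS0 => exists_isMinimalProjection_of_countable h hS hS0
  tfae_have 4 → 5 := not_exists_injective_of_subalgebras
  tfae_have 5 → 6 := fun h a ha => countable_quasispectrum_of_not_exists_injective h ha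
  tfae_have 6 → 1 := fun h B _ π hπ _ => exists_isMinimalProjection_of_countable_of_surjective h hπ
  tfae_finish
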